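/- Write $\langle x\rangle=(1+|x|^2)^{1/2}$ and $L^p_\delta=\{\varphi:\langle\cdot\rangle^{\delta}\varphi\in L^p(\mathbb R^3)\}$. Let $\varepsilon>0$ and let $V:\mathbb R^3\to\mathbb C$ satisfy $V\in C^5(\mathbb R^3)$, $V\in L^2_{3/2+\varepsilon}$ and $\partial^\alpha V\in L^\infty_{1/2+\varepsilon}$ for all $|\alpha|\le 2$. There is $k_0>0$, depending only on $V$ and $\varepsilon$, such that the following holds for every $k>k_0$. Let $(\Omega,\mathcal F,\mathbb P)$ be a probability space, $D\subset\mathbb R^3$ a bounded open set, $m>2$, and let $f$ be a microlocally isotropic generalised Gaussian random distribution of rough order $-m$ and rough strength $\mu$ in $D$; that is, $f(\cdot,\omega)\in\mathscr S'(\mathbb R^3)$ for each $\omega$ and * for each $\varphi\in\mathscr S(\mathbb R^3)$, $\omega\mapsto\langle f(\cdot,\omega),\varphi\rangle$ is a (complex, possibly degenerate) Gaussian random variable; * $\mathbb E f\in C_c^\infty(\mathbb R^3)$ with $\operatorname{supp}\mathbb E f\subset D$, and $\operatorname{supp} f(\cdot,\omega)\subset D$ almost surely; * the covariance operator $(\mathfrak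 C_f\varphi)(\psi)=\mathbb E\big(\langle\overline{f-\mathbb E f},\varphi\rangle\langle f-\mathbb E f,\psi\rangle\big)$ is a classical pseudodifferential operator of order $-m$ with principal symbol $\mu(x)|\xi|^{-m}$, where $\mu\in C_c^\infty(\mathbb R^3;\mathbb R)$, $\mu\ge 0$ and $\operatorname{supp}\mu\subset D$. Let $\Phi_k(x,y)=\frac{e^{ik|x-y|}}{4\pi|x-y|}$, let $\mathcal R_k g(x)=\int\Phi_k(x,y)g(y)\,dy$ for functions $g$, and $\mathcal R_kf(x)=\langle f,\Phi_k(x,\cdot)\rangle$ (in the sense of distributions in $x$). Then there is $\Omega_0\subset\Omega$ with $\mathbb P(\Omega_0)=0$ such that for every $\omega\in\Omega\setminus\Omega_0$: * $\mathcal R_kf(\cdot,\omega)$ is a locally integrable function, and $(I-V\mathcal R_k)g=f(\cdot,\omega)$ has exactly one solution of the form $g=f(\cdot,\omega)+h$ with $h\in L^2_{1/2+\varepsilon}$, written $g=(I-V\mathcal R_k)^{-1}f$; moreover $h\in L^1(\mathbb R^3)$; * the far-field pattern $$u^\infty(\hat x,k,\omega)=\frac{-1}{4\pi}\int_{\mathbb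 R^3}e^{-ik\hat x\cdot y}\,\big((I-V\mathcal R_k)^{-1}f\big)(y)\,dy=\frac{-1}{4\pi}\Big(\big\langle f(\cdot,\omega),e^{-ik\hat x\cdot(\cdot)}\big\rangle+\int_{\mathbb R^3}e^{-ik\hat x\cdot y}h(y)\,dy\Big),\quad\hat x\in\mathbb S^2,$$ satisfies $u^\infty(\cdot,k,\omega)\in L^2(\mathbb S^2)$. -/

import Mathlib

open MeasureTheory ProbabilityTheory Filter Topology Complex
open scoped SchwartzMap FourierTransform

noncomputable section

namespace FarField

/-- Euclidean three-space. -/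
abbrev R3 : Type := EuclideanSpace ℝ (Fin 3)

/-- The Japanese bracket `⟨x⟩ = (1 + |x|²)^{1/2}`. -/
def japanese (x : R3) : ℝ := Real.sqrt (1 + ‖x‖ ^ 2)

/-- Membership in the weighted space `L^p_δ(ℝ³)`: the function `⟨·⟩^δ φ` lies in `L^p(ℝ³)`. -/
def MemWeightedLp {F : Type*} [NormedAddCommGroup F] [NormedSpace ℝ F]
    (δ : ℝ) (p : ENNReal) (φ : R3 → F) : Prop :=
  MemLp (fun x => (japanese x) ^ δ • φ x) p volume

/-- The assumption on the potential: `V ∈ C⁵(ℝ³)`, `V ∈ L²_{3/2+ε}(ℝ³)`, and all the partial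
derivatives of `V` of order at most two lie in `L^∞_{1/2+ε}(ℝ³)`. -/
structure AdmissiblePotential (V : R3 → ℂ) (ε : ℝ) : Prop where
  contDiff : ContDiff ℝ 5 V
  memL2 : MemWeightedLp (3 / 2 + ε) 2 V
  derivs : ∀ j : ℕ, j ≤ 2 → MemWeightedLp (1 / 2 + ε) ⊤ (iteratedFDeriv ℝ j V)

/-! ### Classical pseudodifferential operators -/

/-- The estimates of the symbol class `S^d` at frequencies in `W`:
`|∂_x^α ∂_ξ^β c(x, ξ)| ≤ C_{α,β} ⟨ξ⟩^{d - |β|}` for all `x ∈ ℝ³` and all `ξ ∈ W`. -/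
def SymbolBounds (d : ℝ) (W : Set R3) (c : R3 × R3 → ℂ) : Prop :=
  ∀ a b : ℕ, ∃ C : ℝ, ∀ x : R3, ∀ ξ ∈ W,
    ‖iteratedFDeriv ℝ a (fun x' => iteratedFDeriv ℝ b (fun ξ' => c (x', ξ')) ξ) x‖
      ≤ C * (japanese ξ) ^ (d - b)

/-- `c` is a classical (polyhomogeneous) symbol of order `d` with principal symbol `c₀`: it is a
smooth element of `S^d`, and there are functions `c_j`, smooth off `ξ = 0` and positively
homogeneous of degree `d - j` in `ξ`, with `c ∼ ∑ c_j`, whose leading term is `c₀`. -/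
def IsClassicalSymbol (d : ℝ) (c₀ c : R3 × R3 → ℂ) : Prop :=
  ContDiff ℝ (⊤ : ℕ∞) c ∧ SymbolBounds d Set.univ c ∧
  ∃ hom : ℕ → R3 × R3 → ℂ,
    (∀ j, ContDiffOn ℝ (⊤ : ℕ∞) (hom j) {p | p.2 ≠ 0}) ∧
    (∀ (j : ℕ) (x ξ : R3) (t : ℝ), ξ ≠ 0 → 0 < t →
      hom j (x, t • ξ) = ((t ^ (d - j) : ℝ) : ℂ) * hom j (x, ξ)) ∧
    (∀ x ξ : R3, ξ ≠ 0 → hom 0 (x, ξ) = c₀ (x, ξ)) ∧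
    ∀ N : ℕ, SymbolBounds (d - N) {ξ | 1 ≤ ‖ξ‖}
      (fun p => c p - ∑ j ∈ Finset.range N, hom j p)

/-- The pseudodifferential operator with symbol `c`,
`(Op(c) φ)(x) = (2π)^{-3} ∫ e^{i x·ξ} c(x, ξ) (∫ e^{-i y·ξ} φ(y) dy) dξ`.
The inner integral is the value at `ξ / (2π)` of Mathlib's Fourier transform `𝓕 φ`. -/
def pseudoDiffOp (c : R3 × R3 → ℂ) (φ : R3 → ℂ) (x : R3) : ℂ :=
  ((2 * Real.pi : ℂ) ^ 3)⁻¹ *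
    ∫ ξ : R3, exp (I * (inner ℝ x ξ : ℝ)) * c (x, ξ) * 𝓕 φ ((2 * Real.pi)⁻¹ • ξ)

/-! ### Microlocally isotropic Gaussian random distributions -/

section Random

variable {Ω : Type*} [MeasurableSpace Ω]

/-- The pairing `⟨T̄, φ⟩` of the complex conjugate of `T` with `φ`. -/
def conjPair (T : 𝓢(R3, ℂ) → ℂ) (φ : 𝓢(R3, ℂ)) : ℂ :=
  (starRingEnd ℂ) (T (SchwartzMap.postcompCLM (conjCLE : ℂ →L[ℝ] ℂ) φ))

/-- The centred pairing `⟨f(·, ω) - 𝔼 f, φ⟩`. -/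
def centredPair (P : Measure Ω) (f : Ω → 𝓢'(R3, ℂ)) (ω : Ω) (φ : 𝓢(R3, ℂ)) : ℂ :=
  f ω φ - ∫ ω', f ω' φ ∂P

/-- The covariance `(ℭ_f φ)(ψ) = 𝔼 (⟨conj (f - 𝔼 f), φ⟩ ⟨f - 𝔼 f, ψ⟩)`. -/
def covarianceForm (P : Measure Ω) (f : Ω → 𝓢'(R3, ℂ)) (φ ψ : 𝓢(R3, ℂ)) : ℂ :=
  ∫ ω, conjPair (centredPair P f ω) φ * centredPair P f ω ψ ∂P

/-- `f` is a microlocally isotropic generalised Gaussian random distribution of rough order `-m`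
and rough strength `μ` in `D`. -/
structure IsMIGR (P : Measure Ω) (f : Ω → 𝓢'(R3, ℂ)) (D : Set R3) (m : ℝ) (μ : R3 → ℝ) :
    Prop where
  gaussian : ∀ φ : 𝓢(R3, ℂ), HasGaussianLaw (fun ω => f ω φ) P
  mean : ∃ a : R3 → ℂ, ContDiff ℝ (⊤ : ℕ∞) a ∧ HasCompactSupport a ∧ tsupport a ⊆ D ∧
    ∀ φ : 𝓢(R3, ℂ), ∫ ω, f ω φ ∂P = ∫ x, a x * φ x
  supported : ∀ᵐ ω ∂P, Distribution.dsupport (f ω) ⊆ D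
  strength_contDiff : ContDiff ℝ (⊤ : ℕ∞) μ
  strength_compact : HasCompactSupport μ
  strength_supported : tsupport μ ⊆ D
  strength_nonneg : ∀ x, 0 ≤ μ x
  covariance : ∃ c : R3 × R3 → ℂ,
    IsClassicalSymbol (-m) (fun p => ((μ p.1 * ‖p.2‖ ^ (-m) : ℝ) : ℂ)) c ∧
    ∀ φ ψ : 𝓢(R3, ℂ), covarianceForm P f φ ψ = ∫ x, pseudoDiffOp c φ x * ψ x

end Random

/-! ### The free resolvent and the far-field pattern -/

/-- The outgoing fundamental solution `Φ_k(x, y) = e^{ik|x-y|} / (4π|x-y|)`. -/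
def fundSol (k : ℝ) (x y : R3) : ℂ :=
  exp (I * (k * ‖x - y‖ : ℝ)) / ((4 * Real.pi * ‖x - y‖ : ℝ) : ℂ)

/-- The resolvent of a function, `(R_k g)(x) = ∫ Φ_k(x, y) g(y) dy`. -/
def resolvent (k : ℝ) (g : R3 → ℂ) (x : R3) : ℂ :=
  ∫ y, fundSol k x y * g y

open Classical in
/-- The pairing `⟨T, ψ⟩` of a compactly supported distribution `T` with a smooth function `ψ`:
the value of `T` at any Schwartz function that agrees with `ψ` in a neighbourhood of the support
of `T` (the value does not depend on the choice). -/
def pairSmooth (T : 𝓢'(R3, ℂ)) (ψ : R3 → ℂ) : ℂ :=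
  if hT : ∃ φ : 𝓢(R3, ℂ), ∀ᶠ x in 𝓝ˢ (Distribution.dsupport T), φ x = ψ x then
    T hT.choose
  else 0

/-- The distribution `R_k T = ⟨T, Φ_k(x, ·)⟩`, for a compactly supported distribution `T`, is the
locally integrable function `w`. In the sense of distributions this means
`∫ w(x) φ(x) dx = ⟨T, R_k φ⟩` for all test functions `φ ∈ C_c^∞(ℝ³)`. -/
def IsResolventOf (k : ℝ) (T : 𝓢'(R3, ℂ)) (w : R3 → ℂ) : Prop :=
  LocallyIntegrable w volume ∧
    ∀ φ : 𝓢(R3, ℂ), HasCompactSupport φ → ∫ x, w x * φ x = pairSmooth T (resolvent k φ)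

/-- `T + h` is a solution `g` of `(I - V R_k) g = T` with `h ∈ L²_{1/2+ε}(ℝ³)`.
As `(I - V R_k)(T + h) = T + h - V (R_k T + R_k h)`, the equation says that
`h = V (R_k T + R_k h)`. -/
def IsInverseCorrection (V : R3 → ℂ) (ε k : ℝ) (T : 𝓢'(R3, ℂ)) (h : R3 → ℂ) : Prop :=
  MemWeightedLp (1 / 2 + ε) 2 h ∧
    ∃ w : R3 → ℂ, IsResolventOf k T w ∧ ∀ᵐ x, h x = V x * (w x + resolvent k h x)

/-- `(I - V R_k)^{-1} T` exists in `T + L²_{1/2+ε}(ℝ³)` and is unique there. -/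
def HasInverse (V : R3 → ℂ) (ε k : ℝ) (T : 𝓢'(R3, ℂ)) : Prop :=
  ∃ h, IsInverseCorrection V ε k T h ∧
    ∀ h', IsInverseCorrection V ε k T h' → h' =ᵐ[volume] h

open Classical in
/-- The function part `h` of the distribution `(I - V R_k)^{-1} T = T + h`. -/
def inverseCorrection (V : R3 → ℂ) (ε k : ℝ) (T : 𝓢'(R3, ℂ)) : R3 → ℂ :=
  if hT : HasInverse V ε k T then hT.choose else 0

/-- The plane wave `y ↦ e^{-ik x̂·y}`. -/
def planeWave (k : ℝ) (θ : R3) (y : R3) : ℂ :=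
  exp (-(I * (k * inner ℝ θ y : ℝ)))

/-- The far-field pattern
`u^∞(x̂, k) = -(1/4π) ∫ e^{-ik x̂·y} ((I - V R_k)^{-1} T)(y) dy`, where the integral against the
distribution `(I - V R_k)^{-1} T = T + h` is the pairing with `T` plus the integral against `h`. -/
def farField (V : R3 → ℂ) (ε k : ℝ) (T : 𝓢'(R3, ℂ)) (θ : Metric.sphere (0 : R3) 1) : ℂ :=
  (-1 / (4 * Real.pi) : ℂ) *
    (pairSmooth T (planeWave k θ) + ∫ y, planeWave k θ y * inverseCorrection V ε k T y)

end FarField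

end

/-! Deterministic half. Conjugation by ⟨x⟩^{1/2+ε} turns V R_k on L²_{1/2+ε} into an integral
operator A_k on L². It is Hilbert-Schmidt, since ⟨x⟩^{1/2+ε} V ∈ L² and ∫ |x-y|⁻² ⟨y⟩^{-1-2ε} dy is
bounded in x. Its Hilbert-Schmidt norm does not depend on k, but the kernel of A_k* A_k at (y, z) is
an oscillatory integral with phase k(|x-z| - |x-y|), which tends to zero for y ≠ z by the
Riemann-Lebesgue lemma. By dominated convergence ‖A_k‖⁴ ≤ ‖A_k* A_k‖²_HS → 0
(`tendsto_lintegral_gramKernel`, `norm_toCLM_le`). Hence there is k₀, fixed before any source is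
chosen, beyond which V R_k is a contraction, and h = V (R_k f + R_k h) is uniquely solvable once V
R_k f ∈ L²_{1/2+ε}.

Random half. The covariance operator has order -m with m > 3/2, so it maps L² to L^∞, and 𝔼|⟨f, ψ⟩|²
≤ C ‖ψ‖²_{L²} for ψ supported in a fixed ball (`IsMIGR.exists_lintegral_sq_le`). Let ρ > 0 be a
continuous weight in L² and χ a cutoff equal to one near D. The map φ/ρ ↦ χ R_k φ is
Hilbert-Schmidt, so for test functions e_i with e_i/ρ orthonormal the sum of 𝔼|⟨f, χ R_k e_i⟩|² is
finite. Almost surely the coefficients are therefore square-summable, and a vector of L² represents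
φ ↦ ⟨f, χ R_k φ⟩; this gives a function R_k f with ρ R_k f ∈ L² (`IsMIGR.ae_exists_isResolventOf`).

The choice ρ = ⟨x⟩^{1/2+ε}|V| + ⟨x⟩^{-3/2-ε} joins the halves: the first term puts V R_k f in
L²_{1/2+ε}, the second, with V ∈ L²_{3/2+ε}, puts it in L¹. Then h ∈ L¹, and the far field is
continuous on the sphere, hence square-integrable. -/

noncomputable section

namespace FarField

/-! ### Convergence of Schwartz functions with support in a fixed compact set. -/

section TestFunctions

variable {E : Type*} [NormedAddCommGroup E] [NormedSpace ℝ E]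

/-- All derivatives of a Schwartz function, as continuous functions with the compact-open
topology. -/
def jet (ψ : 𝓢(E, ℂ)) (n : ℕ) : C(E, E [×n]→L[ℝ] ℂ) :=
  ⟨iteratedFDeriv ℝ n ψ, (ψ.smooth n).continuous_iteratedFDeriv'⟩

/-- For Schwartz functions supported in a fixed compact set, local uniform convergence of all
derivatives implies convergence in the Schwartz space. -/
theorem tendsto_of_tendsto_jet {ι : Type*} {l : Filter ι} {K : Set E} (hK : IsCompact K)
    {ψ : ι → 𝓢(E, ℂ)} {ψ₀ : 𝓢(E, ℂ)} (hψ : ∀ i, tsupport (ψ i) ⊆ K) (hψ₀ : tsupport ψ₀ ⊆ K)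
    (h : Tendsto (fun i => jet (ψ i)) l (𝓝 (jet ψ₀))) : Tendsto ψ l (𝓝 ψ₀) := by
  rw [(schwartz_withSeminorms ℝ E ℂ).tendsto_nhds]
  rintro ⟨k, n⟩ ε hε
  obtain ⟨R, hR⟩ := hK.isBounded.exists_norm_le
  have hR0 : 0 < max R 0 + 1 := by positivity
  have hn := tendsto_pi_nhds.1 h n
  rw [ContinuousMap.tendsto_iff_forall_isCompact_tendstoUniformlyOn] at hn
  have hu := hn K hK
  rw [Metric.tendstoUniformlyOn_iff] at hu
  -- On `K` the factor `‖x‖ ^ k` is at most `(max R 0 + 1) ^ k`, so this tolerance bounds the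
  -- seminorm by `ε / 2`, strictly below `ε`.
  set δ := ε / 2 / (max R 0 + 1) ^ k with hδ
  have hδ0 : 0 < δ := by positivity
  filter_upwards [hu δ hδ0] with i hi
  refine lt_of_le_of_lt (SchwartzMap.seminorm_le_bound ℝ k n _ (M := ε / 2) (by positivity) ?_)
    (by linarith)
  intro x
  have hsub : iteratedFDeriv ℝ n (⇑(ψ i - ψ₀)) x
      = iteratedFDeriv ℝ n (ψ i) x - iteratedFDeriv ℝ n ψ₀ x := by
    have : (⇑(ψ i - ψ₀) : E → ℂ) = (ψ i : E → ℂ) - (ψ₀ : E → ℂ) := rfl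
    rw [this, iteratedFDeriv_sub_apply]
    · exact ((ψ i).smooth n).contDiffAt
    · exact (ψ₀.smooth n).contDiffAt
  by_cases hx : x ∈ K
  · have h1 := hi x hx
    rw [dist_comm, dist_eq_norm] at h1
    rw [hsub]
    calc ‖x‖ ^ k * ‖iteratedFDeriv ℝ n (ψ i) x - iteratedFDeriv ℝ n ψ₀ x‖
        ≤ (max R 0 + 1) ^ k * δ := by
          gcongr
          · exact (hR x hx).trans ((le_max_left _ _).trans (by linarith))
          · exact h1.le
      _ = ε / 2 := by rw [hδ]; field_simp
  · have z1 : iteratedFDeriv ℝ n (ψ i) x = 0 := by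
      by_contra hne
      exact hx (hψ i (support_iteratedFDeriv_subset n (Function.mem_support.2 hne)))
    have z2 : iteratedFDeriv ℝ n ψ₀ x = 0 := by
      by_contra hne
      exact hx (hψ₀ (support_iteratedFDeriv_subset n (Function.mem_support.2 hne)))
    rw [hsub, z1, z2]
    simp only [sub_zero, norm_zero, mul_zero]
    positivity

/-- The derivatives in the second variable of a jointly smooth function are jointly continuous. -/
theorem continuous_iteratedFDeriv_prodMk {F : Type*} [NormedAddCommGroup F] [NormedSpace ℝ F]
    {g : F × E → ℂ} (hg : ContDiff ℝ (⊤ : ℕ∞) g) (n : ℕ) :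
    Continuous fun p : F × E => iteratedFDeriv ℝ n (fun x => g (p.1, x)) p.2 := by
  have key : ∀ p : F × E, iteratedFDeriv ℝ n (fun x => g (p.1, x)) p.2
      = (iteratedFDeriv ℝ n g p).compContinuousLinearMap
          fun _ => ContinuousLinearMap.inr ℝ F E := by
    rintro ⟨t, x⟩
    have h1 : (fun x => g (t, x)) =
        (fun q => g ((t, 0) + q)) ∘ (ContinuousLinearMap.inr ℝ F E) := by
      ext y; simp
    have h2 : ContDiff ℝ (⊤ : ℕ∞) fun q => g ((t, 0) + q) := by fun_prop
    simp only
    rw [h1, ContinuousLinearMap.iteratedFDeriv_comp_right _ h2 x (i := n) (mod_cast le_top),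
      iteratedFDeriv_comp_add_left]
    simp
  simp_rw [key]
  have hc : Continuous (iteratedFDeriv ℝ n g) :=
    hg.continuous_iteratedFDeriv (mod_cast le_top)
  exact (ContinuousMultilinearMap.compContinuousLinearMapL
    fun _ : Fin n => ContinuousLinearMap.inr ℝ F E).continuous.comp hc

/-- A jointly smooth family of functions, supported in a fixed compact set, is continuous as a
family of Schwartz functions. -/
theorem continuous_toSchwartzMap {F : Type*} [NormedAddCommGroup F] [NormedSpace ℝ F]
    [LocallyCompactSpace E] {g : F × E → ℂ} (hg : ContDiff ℝ (⊤ : ℕ∞) g) {K : Set E}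
    (hK : IsCompact K) {Ψ : F → 𝓢(E, ℂ)} (hΨ : ∀ t x, Ψ t x = g (t, x))
    (hsupp : ∀ t, tsupport (Ψ t) ⊆ K) : Continuous Ψ := by
  rw [continuous_iff_continuousAt]
  intro t
  refine tendsto_of_tendsto_jet hK hsupp (hsupp t) ?_
  refine tendsto_pi_nhds.2 fun n => ?_
  have hc := continuous_iteratedFDeriv_prodMk hg n
  -- Currying turns joint continuity into continuity for the compact-open topology.
  have h1 : ∀ s, jet (Ψ s) n = ContinuousMap.curry
      ⟨fun p : F × E => iteratedFDeriv ℝ n (fun x => g (p.1, x)) p.2, hc⟩ s := by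
    intro s
    ext1 x
    have : (Ψ s : E → ℂ) = fun x => g (s, x) := funext (hΨ s)
    simp [jet, this]
  simp_rw [h1]
  exact (ContinuousMap.continuous _).tendsto t

/-- A countable family that is dense for the topology of a second countable space together with
the Schwartz topology. -/
theorem exists_seq_dense {X H : Type*} [Nonempty X] [TopologicalSpace H]
    [SecondCountableTopology H] [FiniteDimensional ℝ E] {K : Set E} (hK : IsCompact K)
    (Ψ : X → 𝓢(E, ℂ)) (hΨ : ∀ x, tsupport (Ψ x) ⊆ K) (N : X → H) :
    ∃ u : ℕ → X, ∀ x, ∃ s : ℕ → ℕ, Tendsto (fun n => Ψ (u (s n))) atTop (𝓝 (Ψ x)) ∧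
      Tendsto (fun n => N (u (s n))) atTop (𝓝 (N x)) := by
  have : ProperSpace E := FiniteDimensional.proper ℝ E
  -- The target of `G` is second countable, so its range is separable. One sequence then
  -- approximates the jets and the values of `N` simultaneously, with no topology on `X`.
  let G : X → ((n : ℕ) → C(E, E [×n]→L[ℝ] ℂ)) × H := fun x => (jet (Ψ x), N x)
  have : ∀ n : ℕ, SecondCountableTopology (E [×n]→L[ℝ] ℂ) := fun n => by
    have : FiniteDimensional ℝ (E [×n]→L[ℝ] ℂ) := FiniteDimensional.of_injective
      (ContinuousMultilinearMap.toMultilinearMapLinear (R' := ℝ) (A := ℝ))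
      ContinuousMultilinearMap.toMultilinearMap_injective
    have : ProperSpace (E [×n]→L[ℝ] ℂ) := FiniteDimensional.proper ℝ _
    infer_instance
  obtain ⟨u, hu⟩ : ∃ u : ℕ → X, Set.range G ⊆ closure (Set.range (G ∘ u)) := by
    obtain ⟨d, hd⟩ := TopologicalSpace.exists_dense_seq (Set.range G)
    choose u hu using fun n => (d n).2
    refine ⟨u, ?_⟩
    rintro y hy
    have h1 := hd ⟨y, hy⟩
    rw [closure_subtype] at h1
    refine closure_mono ?_ h1
    rintro _ ⟨_, ⟨n, rfl⟩, rfl⟩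
    exact ⟨n, hu n⟩
  refine ⟨u, fun x => ?_⟩
  obtain ⟨y, hy, hlim⟩ := mem_closure_iff_seq_limit.1 (hu ⟨x, rfl⟩)
  choose s hs using hy
  refine ⟨s, ?_, ?_⟩
  · refine tendsto_of_tendsto_jet hK (fun _ => hΨ _) (hΨ x) ?_
    have := (continuous_fst.tendsto _).comp hlim
    refine this.congr fun n => ?_
    simp [← hs n, G]
  · have := (continuous_snd.tendsto _).comp hlim
    refine this.congr fun n => ?_
    simp [← hs n, G]

end TestFunctions

/-! ### Supports of distributions and the pairing with smooth functions. -/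

section Support

/-- A smooth cutoff function: one on the ball of radius `|R| + 1`, and supported in the ball of
radius `|R| + 2`. -/
def cutoffBump (R : ℝ) : ContDiffBump (0 : R3) :=
  ⟨|R| + 1, |R| + 2, by positivity, by linarith⟩

/-- The complex-valued version of `cutoffBump`. -/
def cutoff (R : ℝ) (x : R3) : ℂ := ((cutoffBump R x : ℝ) : ℂ)

theorem contDiff_cutoff (R : ℝ) : ContDiff ℝ (⊤ : ℕ∞) (cutoff R) :=
  Complex.ofRealCLM.contDiff.comp (cutoffBump R).contDiff

theorem tsupport_cutoff (R : ℝ) : tsupport (cutoff R) ⊆ Metric.closedBall 0 (|R| + 2) := by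
  have h := (cutoffBump R).tsupport_eq
  have : tsupport (cutoff R) ⊆ tsupport (cutoffBump R) := by
    refine closure_mono fun x hx => ?_
    simpa [cutoff] using hx
  exact this.trans h.le

theorem hasCompactSupport_cutoff (R : ℝ) : HasCompactSupport (cutoff R) :=
  (isCompact_closedBall 0 (|R| + 2)).of_isClosed_subset (isClosed_tsupport _) (tsupport_cutoff R)

theorem cutoff_eq_one {R : ℝ} {x : R3} (hx : ‖x‖ ≤ |R| + 1) : cutoff R x = 1 := by
  have := (cutoffBump R).one_of_mem_closedBall (x := x)
    (mem_closedBall_zero_iff.2 hx)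
  simp [cutoff, this]

theorem norm_cutoff_le (R : ℝ) (x : R3) : ‖cutoff R x‖ ≤ 1 := by
  simp only [cutoff, Complex.norm_real, Real.norm_eq_abs, abs_of_nonneg (cutoffBump R).nonneg]
  exact (cutoffBump R).le_one

/-- The product of the cutoff function and a smooth function, as a Schwartz function. -/
def cutoffMul (R : ℝ) (g : R3 → ℂ) (hg : ContDiff ℝ (⊤ : ℕ∞) g) : 𝓢(R3, ℂ) :=
  HasCompactSupport.toSchwartzMap (f := fun x => cutoff R x * g x)
    (hasCompactSupport_cutoff R).mul_right ((contDiff_cutoff R).mul hg)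

@[simp] theorem cutoffMul_apply (R : ℝ) (g : R3 → ℂ) (hg : ContDiff ℝ (⊤ : ℕ∞) g) (x : R3) :
    cutoffMul R g hg x = cutoff R x * g x := rfl

theorem tsupport_cutoffMul (R : ℝ) (g : R3 → ℂ) (hg : ContDiff ℝ (⊤ : ℕ∞) g) :
    tsupport (cutoffMul R g hg) ⊆ Metric.closedBall 0 (|R| + 2) :=
  (tsupport_mul_subset_left (f := cutoff R) (g := g)).trans (tsupport_cutoff R)

/-- A distribution vanishes on compactly supported test functions whose support does not meet its
own support. -/
theorem apply_eq_zero_of_hasCompactSupport (T : 𝓢'(R3, ℂ)) (u : 𝓢(R3, ℂ))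
    (hu : HasCompactSupport u) (h : Disjoint (tsupport u) (Distribution.dsupport T)) :
    T u = 0 := by
  have hx : ∀ x ∈ tsupport u, ∃ s : Set R3,
      Distribution.IsVanishingOn T s ∧ IsOpen s ∧ x ∈ s := fun x hx =>
    (Distribution.notMem_dsupport_iff x).1 (Set.disjoint_left.1 h hx)
  choose! U hvan hopen hmem using hx
  obtain ⟨t, ht⟩ := hu.isCompact.elim_nhds_subcover' (fun x _ => U x)
    (fun x hx => (hopen x hx).mem_nhds (hmem x hx))
  obtain ⟨f, hf⟩ := SmoothPartitionOfUnity.exists_isSubordinate (modelWithCornersSelf ℝ R3)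
    (isClosed_tsupport u) (fun x : t => U x) (fun x => hopen _ x.1.2)
    (fun y hy => by
      obtain ⟨x, hx, hxy⟩ := Set.mem_iUnion₂.1 (ht hy)
      exact Set.mem_iUnion.2 ⟨⟨x, hx⟩, hxy⟩)
  have hsm : ∀ i, ContDiff ℝ (⊤ : ℕ∞) (fun x => ((f i x : ℝ) : ℂ) * u x) := fun i =>
    (Complex.ofRealCLM.contDiff.comp (contMDiff_iff_contDiff.1 (f i).contMDiff)).mul (u.smooth ⊤)
  have hcs : ∀ i, HasCompactSupport (fun x => ((f i x : ℝ) : ℂ) * u x) := fun i => hu.mul_left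
  have hsum : u = ∑ i, (hcs i).toSchwartzMap (hsm i) := by
    ext x
    rw [sum_apply]
    simp only [HasCompactSupport.toSchwartzMap_toFun]
    change u x = ∑ i, ((f i x : ℝ) : ℂ) * u x
    rw [← Finset.sum_mul]
    by_cases hx : x ∈ tsupport u
    · have := f.sum_eq_one hx
      rw [finsum_eq_sum_of_fintype] at this
      rw [← Complex.ofReal_sum, this]
      simp
    · simp [image_eq_zero_of_notMem_tsupport hx]
  rw [hsum, map_sum]
  refine Finset.sum_eq_zero fun i _ => hvan _ i.1.2 _ ?_
  have h1 : tsupport (fun x => ((f i x : ℝ) : ℂ)) ⊆ tsupport (f i) :=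
    closure_mono fun x hx => by simpa using hx
  exact (tsupport_mul_subset_left (f := fun x => ((f i x : ℝ) : ℂ)) (g := u)).trans
    (h1.trans (hf i))

/-- Dilating the argument by a factor of at most one does not increase derivatives. -/
theorem norm_iteratedFDeriv_comp_smul_le {g : R3 → ℂ} (hg : ContDiff ℝ (⊤ : ℕ∞) g) {c : ℝ}
    (hc0 : 0 ≤ c) (hc : c ≤ 1) (i : ℕ) (x : R3) :
    ‖iteratedFDeriv ℝ i (fun y => g (c • y)) x‖ ≤ ‖iteratedFDeriv ℝ i g (c • x)‖ := by
  have h1 : (fun y => g (c • y)) = g ∘ (c • ContinuousLinearMap.id ℝ R3) := by ext y; simp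
  rw [h1, ContinuousLinearMap.iteratedFDeriv_comp_right _ hg x (i := i) (mod_cast le_top)]
  refine (ContinuousMultilinearMap.norm_compContinuousLinearMap_le _ _).trans ?_
  have h2 : ‖c • ContinuousLinearMap.id ℝ R3‖ ≤ 1 := by
    rw [norm_smul, Real.norm_eq_abs, abs_of_nonneg hc0]
    exact mul_le_one₀ hc (norm_nonneg _) ContinuousLinearMap.norm_id_le
  calc _ ≤ ‖iteratedFDeriv ℝ i g (c • x)‖ * 1 := by
        refine mul_le_mul_of_nonneg_left ?_ (norm_nonneg _)
        exact Finset.prod_le_one (fun _ _ => norm_nonneg _) fun _ _ => h2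
    _ = _ := mul_one _

/-- Every Schwartz function is the limit of its products with dilated cutoff functions. -/
theorem tendsto_cutoff_smul (u : 𝓢(R3, ℂ)) (v : ℕ → 𝓢(R3, ℂ))
    (hv : ∀ n x, v n x = cutoff 0 (((n : ℝ) + 1)⁻¹ • x) * u x) :
    Tendsto v atTop (𝓝 u) := by
  rw [(schwartz_withSeminorms ℝ R3 ℂ).tendsto_nhds]
  rintro ⟨k, m⟩ ε hε
  set θ : R3 → ℂ := fun x => 1 - cutoff 0 x with hθ
  have hθs : ContDiff ℝ (⊤ : ℕ∞) θ := contDiff_const.sub (contDiff_cutoff 0)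
  have hbd : ∀ i : ℕ, ∃ M : ℝ, ∀ x, ‖iteratedFDeriv ℝ i θ x‖ ≤ M := by
    intro i
    rcases Nat.eq_zero_or_pos i with rfl | hi
    · refine ⟨2, fun x => ?_⟩
      rw [norm_iteratedFDeriv_zero]
      refine (norm_sub_le _ _).trans ?_
      have := norm_cutoff_le 0 x
      simp only [norm_one]; linarith
    · have hc : Continuous (iteratedFDeriv ℝ i (cutoff 0)) :=
        (contDiff_cutoff 0).continuous_iteratedFDeriv (mod_cast le_top)
      obtain ⟨M, hM⟩ := hc.bounded_above_of_compact_support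
        ((hasCompactSupport_cutoff 0).iteratedFDeriv i)
      refine ⟨M, fun x => ?_⟩
      have : iteratedFDeriv ℝ i θ x = - iteratedFDeriv ℝ i (cutoff 0) x := by
        have h1 : θ = (fun _ => (1 : ℂ)) - cutoff 0 := rfl
        rw [h1, iteratedFDeriv_sub_apply contDiffAt_const
          ((contDiff_cutoff 0).of_le (mod_cast le_top)).contDiffAt,
          iteratedFDeriv_const_of_ne hi.ne']
        simp
      rw [this, norm_neg]
      exact hM x
  choose M hM using hbd
  -- The difference is supported where `‖x‖ ≥ n + 1`, since the dilated cutoff is one inside. There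
  -- one extra power of `‖x‖`, paid for by the seminorms of index `k + 1`, gains the factor `1 / (n
  -- + 1)`; `B` is the Leibniz constant.
  set B : ℝ := ∑ i ∈ Finset.range (m + 1),
    (m.choose i : ℝ) * M i * SchwartzMap.seminorm ℝ (k + 1) (m - i) u with hB
  have hM0 : ∀ i, 0 ≤ M i := fun i => (norm_nonneg _).trans (hM i 0)
  have hB0 : 0 ≤ B := Finset.sum_nonneg fun i _ =>
    mul_nonneg (mul_nonneg (Nat.cast_nonneg _) (hM0 i)) (apply_nonneg _ _)
  have hlim : Tendsto (fun n : ℕ => B / ((n : ℝ) + 1)) atTop (𝓝 0) :=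
    tendsto_const_nhds.div_atTop (tendsto_natCast_atTop_atTop.atTop_add tendsto_const_nhds)
  filter_upwards [hlim.eventually (gt_mem_nhds hε)] with n hn
  have hn0 : (0 : ℝ) < (n : ℝ) + 1 := by positivity
  refine lt_of_le_of_lt (SchwartzMap.seminorm_le_bound ℝ k m _ (M := B / ((n : ℝ) + 1))
    (by positivity) fun x => ?_) hn
  have hvu : (⇑(v n - u) : R3 → ℂ) = - fun x => θ (((n : ℝ) + 1)⁻¹ • x) * u x := by
    ext y
    have : (v n - u) y = v n y - u y := rfl
    rw [this, hv]
    simp only [hθ, Pi.neg_apply]; ring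
  rw [hvu, iteratedFDeriv_neg_apply, norm_neg]
  rcases lt_or_ge ‖x‖ ((n : ℝ) + 1) with hx | hx
  · have hz : (fun x => θ (((n : ℝ) + 1)⁻¹ • x) * u x) =ᶠ[𝓝 x] fun _ => 0 := by
      have : ∀ᶠ y in 𝓝 x, ‖y‖ < (n : ℝ) + 1 :=
        continuous_norm.continuousAt.eventually (gt_mem_nhds hx)
      filter_upwards [this] with y hy
      have h1 : ‖((n : ℝ) + 1)⁻¹ • y‖ ≤ |(0 : ℝ)| + 1 := by
        rw [norm_smul, Real.norm_eq_abs, abs_of_nonneg (by positivity), abs_zero, zero_add,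
          inv_mul_le_iff₀ hn0]
        linarith
      simp [hθ, cutoff_eq_one h1]
    have h2 := (hz.iteratedFDeriv ℝ m).self_of_nhds
    rw [h2]
    have : iteratedFDeriv ℝ m (fun _ : R3 => (0 : ℂ)) x = 0 := by
      simp
    rw [this]
    simp only [norm_zero, mul_zero]
    positivity
  · have hprod := norm_iteratedFDeriv_mul_le (𝕜 := ℝ) (N := ((⊤ : ℕ∞) : WithTop ℕ∞))
      (f := fun x => θ (((n : ℝ) + 1)⁻¹ • x)) (g := u)
      (hθs.comp (contDiff_const_smul _)) (u.smooth ⊤) x (n := m) (mod_cast le_top)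
    have hx0 : 0 < ‖x‖ := hn0.trans_le hx
    calc _ ≤ ‖x‖ ^ k * ∑ i ∈ Finset.range (m + 1), (m.choose i : ℝ) *
          ‖iteratedFDeriv ℝ i (fun x => θ (((n : ℝ) + 1)⁻¹ • x)) x‖ *
            ‖iteratedFDeriv ℝ (m - i) u x‖ := by gcongr
      _ ≤ ‖x‖ ^ k * ∑ i ∈ Finset.range (m + 1), (m.choose i : ℝ) * M i *
            (SchwartzMap.seminorm ℝ (k + 1) (m - i) u / ‖x‖ ^ (k + 1)) := by
          gcongr with i hi
          · have := hM0 i; positivity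
          · exact (norm_iteratedFDeriv_comp_smul_le hθs (by positivity)
              (inv_le_one_of_one_le₀ (by linarith [n.cast_nonneg (α := ℝ)])) i x).trans (hM i _)
          · rw [le_div_iff₀ (by positivity), mul_comm]
            exact SchwartzMap.le_seminorm ℝ (k + 1) (m - i) u x
      _ = B / ‖x‖ := by
          rw [hB, Finset.mul_sum, Finset.sum_div]
          refine Finset.sum_congr rfl fun i _ => ?_
          field_simp
          ring
      _ ≤ B / ((n : ℝ) + 1) := by gcongr

/-- A distribution vanishes on test functions whose support does not meet its own support. -/
theorem apply_eq_zero_of_disjoint (T : 𝓢'(R3, ℂ)) (u : 𝓢(R3, ℂ))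
    (h : Disjoint (tsupport u) (Distribution.dsupport T)) : T u = 0 := by
  have hcs : ∀ n : ℕ, HasCompactSupport (fun x => cutoff 0 (((n : ℝ) + 1)⁻¹ • x)) := fun n =>
    (hasCompactSupport_cutoff 0).comp_smul (by positivity)
  have hsm : ∀ n : ℕ, ContDiff ℝ (⊤ : ℕ∞) (fun x => cutoff 0 (((n : ℝ) + 1)⁻¹ • x) * u x) :=
    fun n => ((contDiff_cutoff 0).comp (contDiff_const_smul _)).mul (u.smooth ⊤)
  have hcs' : ∀ n : ℕ, HasCompactSupport (fun x => cutoff 0 (((n : ℝ) + 1)⁻¹ • x) * u x) :=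
    fun n => (hcs n).mul_right
  have hlim := tendsto_cutoff_smul u (fun n => (hcs' n).toSchwartzMap (hsm n)) fun n x => rfl
  have hT := ((map_continuous T).tendsto u).comp hlim
  refine tendsto_nhds_unique hT ?_
  have : ∀ n : ℕ, T ((hcs' n).toSchwartzMap (hsm n)) = 0 := fun n =>
    apply_eq_zero_of_hasCompactSupport T _ (hcs' n)
      (h.mono_left (tsupport_mul_subset_right (f := fun x => cutoff 0 (((n : ℝ) + 1)⁻¹ • x))
        (g := u)))
  refine tendsto_const_nhds.congr fun n => ?_
  exact (this n).symm

/-- The pairing with a smooth function is the value at its product with a cutoff function. -/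
theorem pairSmooth_eq {T : 𝓢'(R3, ℂ)} {R : ℝ}
    (hT : Distribution.dsupport T ⊆ Metric.closedBall 0 R) {ψ : R3 → ℂ}
    (hψ : ContDiff ℝ (⊤ : ℕ∞) ψ) : pairSmooth T ψ = T (cutoffMul R ψ hψ) := by
  have hnear : ∀ᶠ x in 𝓝ˢ (Distribution.dsupport T), cutoffMul R ψ hψ x = ψ x := by
    have h1 : Metric.ball (0 : R3) (|R| + 1) ∈ 𝓝ˢ (Distribution.dsupport T) := by
      refine Metric.isOpen_ball.mem_nhdsSet.2 (hT.trans ?_)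
      exact Metric.closedBall_subset_ball (by linarith [le_abs_self R])
    filter_upwards [h1] with x hx
    rw [cutoffMul_apply, cutoff_eq_one, one_mul]
    exact (mem_ball_zero_iff.1 hx).le
  have hex : ∃ φ : 𝓢(R3, ℂ), ∀ᶠ x in 𝓝ˢ (Distribution.dsupport T), φ x = ψ x := ⟨_, hnear⟩
  rw [pairSmooth, dif_pos hex, ← sub_eq_zero, ← map_sub]
  -- The chosen extension is only known near the support and need not have compact support, so the
  -- vanishing statement for general Schwartz functions is needed.
  refine apply_eq_zero_of_disjoint T _ ?_
  have h2 : ∀ᶠ x in 𝓝ˢ (Distribution.dsupport T), (hex.choose - cutoffMul R ψ hψ) x = 0 := by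
    filter_upwards [hnear, hex.choose_spec] with x hx hx'
    have : (hex.choose - cutoffMul R ψ hψ) x = hex.choose x - cutoffMul R ψ hψ x := rfl
    rw [this, hx, hx', sub_self]
  rw [Set.disjoint_right]
  intro x hx
  rw [notMem_tsupport_iff_eventuallyEq]
  exact (eventually_nhdsSet_iff_forall.1 h2) x hx

end Support

/-! ### Plane waves and the Fourier transform of a compactly supported distribution. -/

section PlaneWave

theorem contDiff_planeWave_prod (k : ℝ) :
    ContDiff ℝ (⊤ : ℕ∞) fun p : R3 × R3 => planeWave k p.1 p.2 := by
  have h : ContDiff ℝ (⊤ : ℕ∞) fun p : R3 × R3 => ((k * inner ℝ p.1 p.2 : ℝ) : ℂ) :=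
    Complex.ofRealCLM.contDiff.comp (contDiff_const.mul (contDiff_fst.inner ℝ contDiff_snd))
  unfold planeWave
  exact ((contDiff_const.mul h).neg).cexp

theorem contDiff_planeWave (k : ℝ) (θ : R3) : ContDiff ℝ (⊤ : ℕ∞) (planeWave k θ) := by
  have h := (contDiff_planeWave_prod k).comp (f := fun y : R3 => (θ, y))
    (contDiff_const.prodMk contDiff_id)
  exact h

theorem norm_planeWave (k : ℝ) (θ y : R3) : ‖planeWave k θ y‖ = 1 := by
  have : -(I * ((k * inner ℝ θ y : ℝ) : ℂ)) = ((-(k * inner ℝ θ y) : ℝ) : ℂ) * I := by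
    push_cast; ring
  rw [planeWave, this, Complex.norm_exp_ofReal_mul_I]

/-- The Fourier transform of a compactly supported distribution is continuous. -/
theorem continuous_pairSmooth_planeWave {T : 𝓢'(R3, ℂ)} {R : ℝ}
    (hT : Distribution.dsupport T ⊆ Metric.closedBall 0 R) (k : ℝ) :
    Continuous fun θ : R3 => pairSmooth T (planeWave k θ) := by
  simp_rw [fun θ => pairSmooth_eq hT (contDiff_planeWave k θ)]
  refine (map_continuous T).comp (continuous_toSchwartzMap
    (g := fun p : R3 × R3 => cutoff R p.2 * planeWave k p.1 p.2)
    (((contDiff_cutoff R).comp contDiff_snd).mul (contDiff_planeWave_prod k))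
    (isCompact_closedBall 0 (|R| + 2)) (fun _ _ => rfl) fun θ => tsupport_cutoffMul _ _ _)

end PlaneWave

/-! ### The weights ⟨x⟩^s and their integrability against |x-y|⁻². -/

section Weights

theorem japanese_eq (x : R3) : japanese x = (1 + ‖x‖ ^ 2) ^ (1 / 2 : ℝ) := Real.sqrt_eq_rpow _

theorem one_le_japanese (x : R3) : 1 ≤ japanese x := by
  rw [japanese, Real.one_le_sqrt]
  nlinarith [norm_nonneg x]

theorem japanese_pos (x : R3) : 0 < japanese x := zero_lt_one.trans_le (one_le_japanese x)

theorem continuous_japanese : Continuous japanese := by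
  unfold japanese
  fun_prop

theorem continuous_japanese_rpow (r : ℝ) : Continuous fun x => japanese x ^ r :=
  continuous_japanese.rpow_const fun x => Or.inl (japanese_pos x).ne'

theorem integrable_japanese_rpow {r : ℝ} (hr : 3 < r) :
    Integrable fun x => japanese x ^ (-r) := by
  have h := integrable_rpow_neg_one_add_norm_sq (E := R3) (μ := volume) (r := r)
    (by simpa using hr)
  refine h.congr (Eventually.of_forall fun x => ?_)
  simp only [japanese_eq]
  rw [← Real.rpow_mul (by positivity)]
  congr 1; ring

theorem memLp_japanese_rpow {r : ℝ} (hr : 3 / 2 < r) :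
    MemLp (fun x => japanese x ^ (-r)) 2 volume := by
  rw [memLp_two_iff_integrable_sq (continuous_japanese_rpow _).aestronglyMeasurable]
  refine (integrable_japanese_rpow (r := 2 * r) (by linarith)).congr
    (Eventually.of_forall fun x => ?_)
  simp only
  rw [← Real.rpow_natCast, ← Real.rpow_mul (japanese_pos x).le]
  congr 1; push_cast; ring

theorem locallyIntegrable_inv_norm_sq : LocallyIntegrable (fun x : R3 => (‖x‖ ^ 2)⁻¹) volume := by
  refine locallyIntegrable_of_norm_le_rpow (C := 1) (α := 2) (by simp) (by simp; norm_num) ?_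
    (by fun_prop)
  refine Eventually.of_forall fun x => ?_
  rw [one_mul, Real.norm_eq_abs, abs_of_nonneg (by positivity), Real.rpow_neg (norm_nonneg x)]
  norm_cast

/-- The singular kernel `|x - y|⁻²` times a weight is dominated by the sum of an integrable
function of `x - y` and an integrable function of `y`. -/
theorem exists_weight_bound {s : ℝ} (hs : 1 < s) : ∃ F G : R3 → ℝ, Integrable F ∧ Integrable G ∧
    ∀ x y, japanese y ^ (-s) * (‖x - y‖ ^ 2)⁻¹ ≤ F (x - y) + G y := by
  -- For `‖z‖ ≤ 1` the weight is at most one and `‖z‖⁻²` is locally integrable. For `‖z‖ > 1`,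
  -- `‖z‖⁻² ≤ 2⟨z⟩⁻²`, and `⟨y⟩^(-s) ⟨z⟩⁻²` is at most `⟨·⟩^(-(2+s))` at whichever of `y`, `z` has
  -- the smaller bracket; `2 + s > 3` makes this integrable.
  refine ⟨fun z => (Metric.closedBall (0 : R3) 1).indicator (fun z => (‖z‖ ^ 2)⁻¹) z
      + 2 * japanese z ^ (-(2 + s)), fun y => 2 * japanese y ^ (-(2 + s)), ?_, ?_, ?_⟩
  · refine Integrable.add ?_ ((integrable_japanese_rpow (by linarith)).const_mul 2)
    rw [integrable_indicator_iff measurableSet_closedBall]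
    exact locallyIntegrable_inv_norm_sq.integrableOn_isCompact (isCompact_closedBall 0 1)
  · exact (integrable_japanese_rpow (by linarith)).const_mul 2
  · intro x y
    simp only
    set z := x - y
    have hy := japanese_pos y
    have hz := japanese_pos z
    have hjy : japanese y ^ (-s) ≤ 1 :=
      Real.rpow_le_one_of_one_le_of_nonpos (one_le_japanese y) (by linarith)
    by_cases hz1 : ‖z‖ ≤ 1
    · rw [Set.indicator_of_mem (mem_closedBall_zero_iff.2 hz1)]
      have h1 : japanese y ^ (-s) * (‖z‖ ^ 2)⁻¹ ≤ 1 * (‖z‖ ^ 2)⁻¹ := by gcongr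
      have h2 : 0 ≤ japanese z ^ (-(2 + s)) := by positivity
      have h3 : 0 ≤ japanese y ^ (-(2 + s)) := by positivity
      linarith
    · push Not at hz1
      rw [Set.indicator_of_notMem (by simpa using hz1)]
      have hsplit : ∀ w : R3, japanese w ^ (-(2 + s)) = (japanese w ^ 2)⁻¹ * japanese w ^ (-s) := by
        intro w
        rw [neg_add, Real.rpow_add (japanese_pos w), Real.rpow_neg (japanese_pos w).le]
        norm_cast
      have h1 : (‖z‖ ^ 2)⁻¹ ≤ 2 * (japanese z ^ 2)⁻¹ := by
        rw [japanese, Real.sq_sqrt (by positivity), ← div_eq_mul_inv, inv_eq_one_div,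
          div_le_div_iff₀ (by positivity) (by positivity)]
        nlinarith
      have h2 : 0 ≤ japanese z ^ (-(2 + s)) := by positivity
      have h3 : 0 ≤ japanese y ^ (-(2 + s)) := by positivity
      have h4 : japanese y ^ (-s) * (‖z‖ ^ 2)⁻¹
          ≤ japanese y ^ (-s) * (2 * (japanese z ^ 2)⁻¹) := by gcongr
      rcases le_total (japanese z) (japanese y) with h | h
      · have h5 : japanese y ^ (-s) ≤ japanese z ^ (-s) :=
          Real.rpow_le_rpow_of_nonpos hz h (by linarith)
        have h6 : japanese y ^ (-s) * (2 * (japanese z ^ 2)⁻¹)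
            ≤ japanese z ^ (-s) * (2 * (japanese z ^ 2)⁻¹) := by gcongr
        rw [hsplit z]
        linarith
      · have h6 : japanese y ^ (-s) * (2 * (japanese z ^ 2)⁻¹)
            ≤ japanese y ^ (-s) * (2 * (japanese y ^ 2)⁻¹) := by gcongr
        rw [hsplit y]
        linarith

end Weights

/-! ### Uniform L² bounds for the fundamental solution. -/

section FundamentalSolution

theorem norm_fundSol (k : ℝ) (x y : R3) : ‖fundSol k x y‖ = (4 * Real.pi)⁻¹ * ‖x - y‖⁻¹ := by
  have : I * ((k * ‖x - y‖ : ℝ) : ℂ) = ((k * ‖x - y‖ : ℝ) : ℂ) * I := mul_comm _ _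
  rw [fundSol, norm_div, this, Complex.norm_exp_ofReal_mul_I, Complex.norm_real,
    Real.norm_eq_abs, abs_of_nonneg (by positivity), one_div, mul_inv]

theorem norm_fundSol_le (k : ℝ) (x y : R3) : ‖fundSol k x y‖ ≤ ‖x - y‖⁻¹ := by
  rw [norm_fundSol]
  have h : (4 * Real.pi)⁻¹ ≤ 1 := inv_le_one_of_one_le₀ (by nlinarith [Real.pi_gt_three])
  exact mul_le_of_le_one_left (by positivity) h

theorem fundSol_comm (k : ℝ) (x y : R3) : fundSol k x y = fundSol k y x := by
  simp [fundSol, norm_sub_rev]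

theorem measurable_fundSol (k : ℝ) : Measurable fun p : R3 × R3 => fundSol k p.1 p.2 := by
  unfold fundSol
  fun_prop

theorem locallyIntegrable_fundSol (k : ℝ) : LocallyIntegrable (fun z => fundSol k z 0) := by
  refine locallyIntegrable_of_norm_le_rpow (C := 1) (α := 1) (by simp) (by simp) ?_
    ((measurable_fundSol k).comp (measurable_id.prodMk measurable_const)).aestronglyMeasurable
  refine Eventually.of_forall fun x => ?_
  rw [one_mul, Real.rpow_neg (norm_nonneg x), Real.rpow_one]
  simpa using norm_fundSol_le k x 0

theorem enorm_fundSol_sq_le (k : ℝ) (x y : R3) :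
    ‖fundSol k x y‖ₑ ^ 2 ≤ ENNReal.ofReal ((‖x - y‖ ^ 2)⁻¹) := by
  rw [← ofReal_norm, ← ENNReal.ofReal_pow (norm_nonneg _)]
  refine ENNReal.ofReal_le_ofReal ?_
  rw [← inv_pow]
  exact pow_le_pow_left₀ (norm_nonneg _) (norm_fundSol_le k x y) 2

/-- The fundamental solution is uniformly bounded in a weighted `L²` space. -/
theorem exists_lintegral_fundSol_le {s : ℝ} (hs : 1 / 2 < s) : ∃ C : ENNReal, C ≠ ⊤ ∧
    ∀ k x, ∫⁻ y, ‖fundSol k x y * ((japanese y ^ (-s) : ℝ) : ℂ)‖ₑ ^ 2 ≤ C := by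
  obtain ⟨F, G, hF, hG, h⟩ := exists_weight_bound (s := 2 * s) (by linarith)
  refine ⟨(∫⁻ z, ‖F z‖ₑ) + ∫⁻ y, ‖G y‖ₑ, ENNReal.add_ne_top.2 ⟨hF.2.ne, hG.2.ne⟩, fun k x => ?_⟩
  calc ∫⁻ y, ‖fundSol k x y * ((japanese y ^ (-s) : ℝ) : ℂ)‖ₑ ^ 2
      ≤ ∫⁻ y, (‖F (x - y)‖ₑ + ‖G y‖ₑ) := by
        refine lintegral_mono fun y => ?_
        have hj : ‖((japanese y ^ (-s) : ℝ) : ℂ)‖ₑ ^ 2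
            = ENNReal.ofReal (japanese y ^ (-(2 * s))) := by
          rw [← ofReal_norm, ← ENNReal.ofReal_pow (norm_nonneg _), Complex.norm_real,
            Real.norm_eq_abs, sq_abs, ← Real.rpow_natCast,
            ← Real.rpow_mul (japanese_pos y).le]
          congr 2; push_cast; ring
        rw [enorm_mul, mul_pow, hj]
        calc _ ≤ ENNReal.ofReal ((‖x - y‖ ^ 2)⁻¹) * ENNReal.ofReal (japanese y ^ (-(2 * s))) := by
              gcongr
              exact enorm_fundSol_sq_le k x y
          _ = ENNReal.ofReal (japanese y ^ (-(2 * s)) * (‖x - y‖ ^ 2)⁻¹) := by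
              rw [mul_comm, ENNReal.ofReal_mul (Real.rpow_nonneg (japanese_pos y).le _)]
          _ ≤ ENNReal.ofReal (F (x - y) + G y) := ENNReal.ofReal_le_ofReal (h x y)
          _ ≤ ENNReal.ofReal (F (x - y)) + ENNReal.ofReal (G y) := ENNReal.ofReal_add_le
          _ ≤ _ := add_le_add (Real.ofReal_le_enorm _) (Real.ofReal_le_enorm _)
    _ = (∫⁻ y, ‖F (x - y)‖ₑ) + ∫⁻ y, ‖G y‖ₑ := by
        rw [lintegral_add_right' _ hG.1.enorm]
    _ = _ := by rw [lintegral_sub_left_eq_self (fun z => ‖F z‖ₑ) x]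

/-- The fundamental solution is uniformly bounded in `L²` of a ball. -/
theorem exists_setLIntegral_fundSol_le (R : ℝ) : ∃ C : ENNReal, C ≠ ⊤ ∧
    ∀ k y, ∫⁻ x in Metric.closedBall (0 : R3) R, ‖fundSol k x y‖ₑ ^ 2 ≤ C := by
  -- On the ball the squared weight `⟨x⟩⁻²` is at least `1 / (1 + R²)`, so inserting it costs a
  -- factor `1 + R²`.
  obtain ⟨C, hC, h⟩ := exists_lintegral_fundSol_le (s := 1) (by norm_num)
  refine ⟨ENNReal.ofReal (1 + R ^ 2) * C, ENNReal.mul_ne_top ENNReal.ofReal_ne_top hC,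
    fun k y => ?_⟩
  calc ∫⁻ x in Metric.closedBall (0 : R3) R, ‖fundSol k x y‖ₑ ^ 2
      ≤ ∫⁻ x in Metric.closedBall (0 : R3) R, ENNReal.ofReal (1 + R ^ 2) *
          ‖fundSol k y x * ((japanese x ^ (-1 : ℝ) : ℝ) : ℂ)‖ₑ ^ 2 := by
        refine setLIntegral_mono' measurableSet_closedBall fun x hx => ?_
        have hx' : ‖x‖ ≤ R := mem_closedBall_zero_iff.1 hx
        have hj : ‖((japanese x ^ (-1 : ℝ) : ℝ) : ℂ)‖ₑ ^ 2
            = ENNReal.ofReal ((1 + ‖x‖ ^ 2)⁻¹) := by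
          rw [← ofReal_norm, ← ENNReal.ofReal_pow (norm_nonneg _), Complex.norm_real,
            Real.norm_eq_abs, sq_abs, Real.rpow_neg_one, inv_pow, japanese,
            Real.sq_sqrt (by positivity)]
        rw [enorm_mul, mul_pow, hj, fundSol_comm k y x, mul_left_comm,
          ← ENNReal.ofReal_mul (by positivity)]
        refine le_mul_of_one_le_right zero_le ?_
        rw [ENNReal.one_le_ofReal, ← div_eq_mul_inv, one_le_div (by positivity)]
        have := pow_le_pow_left₀ (norm_nonneg x) hx' 2
        linarith
    _ ≤ ∫⁻ x, ENNReal.ofReal (1 + R ^ 2) *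
          ‖fundSol k y x * ((japanese x ^ (-1 : ℝ) : ℝ) : ℂ)‖ₑ ^ 2 :=
        setLIntegral_le_lintegral _ _
    _ = ENNReal.ofReal (1 + R ^ 2) *
          ∫⁻ x, ‖fundSol k y x * ((japanese x ^ (-1 : ℝ) : ℝ) : ℂ)‖ₑ ^ 2 :=
        lintegral_const_mul' _ _ ENNReal.ofReal_ne_top
    _ ≤ _ := by gcongr; exact h k y

/-- The resolvent of a test function is smooth. -/
theorem contDiff_resolvent (k : ℝ) {φ : R3 → ℂ} (hφ : HasCompactSupport φ)
    (hs : ContDiff ℝ (⊤ : ℕ∞) φ) : ContDiff ℝ (⊤ : ℕ∞) (resolvent k φ) := by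
  have h := hφ.contDiff_convolution_right (ContinuousLinearMap.mul ℝ ℂ)
    (locallyIntegrable_fundSol k) hs
  convert h using 1
  ext x
  rw [convolution_def, resolvent, ← integral_sub_left_eq_self _ _ x]
  simp [fundSol]

end FundamentalSolution

/-! ### Oscillatory integrals with phase |x-z| - |x-y|. -/

section OscillatoryIntegrals

/-- The preimage of a null set under a function with positive derivative is a null set. -/
theorem volume_preimage_eq_zero_of_deriv_pos {g : ℝ → ℝ} (hg : ∀ t, 0 < deriv g t) {Z : Set ℝ}
    (hZm : MeasurableSet Z) (hZ : volume Z = 0) : volume (g ⁻¹' Z) = 0 := by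
  have hd : ∀ t, DifferentiableAt ℝ g t := fun t =>
    differentiableAt_of_deriv_ne_zero (hg t).ne'
  have hgc : Continuous g := continuous_iff_continuousAt.2 fun t => (hd t).continuousAt
  have hm : MeasurableSet (g ⁻¹' Z) := hgc.measurable hZm
  -- By change of variables the integral of `|g'|` over the preimage is the measure of a subset of
  -- `Z`, hence zero; as `g' > 0`, the preimage is null.
  have h := lintegral_image_eq_lintegral_abs_deriv_mul hm
    (fun t _ => (hd t).hasDerivAt.hasDerivWithinAt)
    (strictMono_of_deriv_pos hg).injective.injOn (fun _ => 1)
  have h0 : volume (g '' (g ⁻¹' Z)) = 0 := measure_mono_null (Set.image_preimage_subset _ _) hZ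
  simp only [mul_one, lintegral_const, Measure.restrict_apply MeasurableSet.univ, Set.univ_inter,
    one_mul, h0] at h
  have h2 := (lintegral_eq_zero_iff ((measurable_deriv g).norm.ennreal_ofReal)).1 h.symm
  rw [Filter.EventuallyEq, ae_restrict_iff' hm] at h2
  have h3 : ∀ᵐ t, t ∉ g ⁻¹' Z := by
    filter_upwards [h2] with t ht htm
    have := ht htm
    simp only [Pi.zero_apply, ENNReal.ofReal_eq_zero, Real.norm_eq_abs] at this
    have := hg t
    linarith [le_abs_self (deriv g t)]
  exact measure_eq_zero_iff_ae_notMem.2 h3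

/-- A set almost all of whose sections by parallel lines are null is a null set. -/
theorem volume_eq_zero_of_forall_line {N : Set R3} (hN : MeasurableSet N) (e : R3)
    (h : ∀ᵐ x : R3, volume {t : ℝ | x + t • e ∈ N} = 0) : volume N = 0 := by
  have hm : MeasurableSet {p : R3 × ℝ | p.1 + p.2 • e ∈ N} :=
    hN.preimage (by fun_prop)
  -- Fubini in two orders: the sections at fixed `x` are null by hypothesis, while those at fixed
  -- `t` are translates of `N`. The interval serves only as a parameter set of measure one.
  have h1 : (volume.prod (volume.restrict (Set.Icc (0 : ℝ) 1)))
      {p : R3 × ℝ | p.1 + p.2 • e ∈ N} = 0 := by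
    rw [Measure.measure_prod_null hm]
    filter_upwards [h] with x hx
    exact measure_mono_null (Set.Subset.refl _)
      (Measure.absolutelyContinuous_of_le Measure.restrict_le_self hx)
  rw [Measure.prod_apply_symm hm] at h1
  have h2 : ∀ t : ℝ, volume ((fun x : R3 => (x, t)) ⁻¹' {p : R3 × ℝ | p.1 + p.2 • e ∈ N})
      = volume N := fun t => measure_preimage_add_right volume (t • e) N
  simp_rw [h2] at h1
  simpa using h1

/-- With `p = x - z` and `q = x - y` this is the derivative of `‖x - z‖ - ‖x - y‖` in the direction
`y - z`. It equals `(‖p‖ + ‖q‖)(1 - cos ∠(p, q))`, so strict Cauchy-Schwarz decides the sign. -/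
theorem inner_sub_lt {p q : R3} (hp : p ≠ 0) (hq : q ≠ 0)
    (h : inner ℝ p q ≠ ‖p‖ * ‖q‖) :
    0 < inner ℝ p (p - q) / ‖p‖ - inner ℝ q (p - q) / ‖q‖ := by
  have hp0 := norm_pos_iff.2 hp
  have hq0 := norm_pos_iff.2 hq
  have hlt : inner ℝ p q < ‖p‖ * ‖q‖ := lt_of_le_of_ne (real_inner_le_norm p q) h
  have : inner ℝ p (p - q) / ‖p‖ - inner ℝ q (p - q) / ‖q‖
      = (‖p‖ + ‖q‖) * (‖p‖ * ‖q‖ - inner ℝ p q) / (‖p‖ * ‖q‖) := by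
    rw [inner_sub_right, inner_sub_right, real_inner_self_eq_norm_sq, real_inner_self_eq_norm_sq,
      real_inner_comm p q]
    field_simp
    ring
  rw [this]
  exact div_pos (mul_pos (by positivity) (by linarith)) (by positivity)

/-- The difference of the distances to two distinct points pulls null sets back to null sets. -/
theorem volume_preimage_norm_sub_norm {y z : R3} (hyz : y ≠ z) {Z : Set ℝ}
    (hZm : MeasurableSet Z) (hZ : volume Z = 0) :
    volume ((fun x : R3 => ‖x - z‖ - ‖x - y‖) ⁻¹' Z) = 0 := by
  have hmeas : Measurable fun x : R3 => ‖x - z‖ - ‖x - y‖ := by fun_prop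
  -- The phase is strictly increasing along every line parallel to `y - z` except the one through
  -- `y` and `z`, and that line is null in three dimensions.
  refine volume_eq_zero_of_forall_line (hmeas hZm) (y - z) ?_
  have hline : volume ((AffineSubspace.mk' z (Submodule.span ℝ {y - z}) :
      AffineSubspace ℝ R3) : Set R3) = 0 := by
    refine Measure.addHaar_affineSubspace _ _ fun htop => ?_
    have h1 := congrArg AffineSubspace.direction htop
    rw [AffineSubspace.direction_mk', AffineSubspace.direction_top] at h1
    have h2 := finrank_span_le_card (R := ℝ) ({y - z} : Set R3)
    rw [h1, finrank_top] at h2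
    simp at h2
  have hline' : ∀ᵐ x : R3, x ∉ AffineSubspace.mk' z (Submodule.span ℝ {y - z}) := 
    measure_eq_zero_iff_ae_notMem.1 hline
  filter_upwards [hline'] with x hx
  have hp : ∀ t c : ℝ, x + t • (y - z) - z ≠ c • (y - z) := by
    intro t c h
    refine hx ?_
    rw [AffineSubspace.mem_mk', vsub_eq_sub]
    have : x - z = (c - t) • (y - z) := by rw [sub_smul, ← h]; abel
    rw [this]
    exact Submodule.smul_mem _ _ (Submodule.mem_span_singleton_self _)
  refine volume_preimage_eq_zero_of_deriv_pos
    (g := fun t : ℝ => ‖x + t • (y - z) - z‖ - ‖x + t • (y - z) - y‖) (fun t => ?_) hZm hZ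
  set p := x + t • (y - z) - z with hpdef
  set q := x + t • (y - z) - y with hqdef
  have hpq : p - q = y - z := by rw [hpdef, hqdef]; abel
  have hp0 : p ≠ 0 := by simpa using hp t 0
  have hq0 : q ≠ 0 := by
    intro h0
    refine hp t 1 ?_
    rw [one_smul, ← hpdef, ← hpq, h0, sub_zero]
  have hder : ∀ w : R3, x + t • (y - z) - w ≠ 0 →
      HasDerivAt (fun t : ℝ => ‖x + t • (y - z) - w‖)
        (inner ℝ (x + t • (y - z) - w) (y - z) / ‖x + t • (y - z) - w‖) t := by
    intro w hw
    have h1 : HasDerivAt (fun t : ℝ => x + t • (y - z) - w) (y - z) t := by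
      simpa using (((hasDerivAt_id t).smul_const (y - z)).const_add x).sub_const w
    have h2 := h1.norm_sq.sqrt (by positivity)
    have h3 : (fun t : ℝ => Real.sqrt (‖x + t • (y - z) - w‖ ^ 2))
        = fun t : ℝ => ‖x + t • (y - z) - w‖ := by
      ext t; exact Real.sqrt_sq (norm_nonneg _)
    rw [h3, Real.sqrt_sq (norm_nonneg _)] at h2
    convert h2 using 1
    field_simp
  have hd := (hder z hp0).sub (hder y hq0)
  have hd' := hd.deriv
  change deriv (fun t : ℝ => ‖x + t • (y - z) - z‖ - ‖x + t • (y - z) - y‖) t = _ at hd'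
  rw [hd', ← hpdef, ← hqdef, ← hpq]
  -- Equality in Cauchy-Schwarz makes `p` and `q` positively parallel. Then either `p = q`,
  -- contradicting `y ≠ z`, or `p` is a multiple of `p - q = y - z`, so `x` lies on the excluded
  -- line.
  refine inner_sub_lt hp0 hq0 fun heq => ?_
  rw [inner_eq_norm_mul_iff_real] at heq
  by_cases hn : ‖q‖ = ‖p‖
  · rw [hn] at heq
    have hpq' : p = q := smul_right_injective R3 (norm_ne_zero_iff.2 hp0) heq
    rw [hpq', sub_self] at hpq
    exact hyz (sub_eq_zero.1 hpq.symm)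
  · refine hp t (-(‖p‖ / (‖q‖ - ‖p‖))) ?_
    rw [← hpdef, ← hpq]
    have hne : ‖q‖ - ‖p‖ ≠ 0 := sub_ne_zero.2 hn
    have h4 : (‖q‖ - ‖p‖) • p = -(‖p‖ • (p - q)) := by
      rw [sub_smul, heq, smul_sub ‖p‖ p q, neg_sub]
    have h5 : p = (‖q‖ - ‖p‖)⁻¹ • ((‖q‖ - ‖p‖) • p) := by
      rw [smul_smul, inv_mul_cancel₀ hne, one_smul]
    conv_lhs => rw [h5, h4]
    rw [smul_neg, smul_smul, neg_smul]
    congr 2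
    field_simp

/-- The Riemann-Lebesgue lemma for a phase function that pulls null sets back to null sets. -/
theorem tendsto_integral_exp_phase {φ : R3 → ℝ} (hφ : Measurable φ)
    (hnull : ∀ Z : Set ℝ, MeasurableSet Z → volume Z = 0 → volume (φ ⁻¹' Z) = 0)
    {F : R3 → ℝ} (hF : Integrable F) (hF0 : ∀ x, 0 ≤ F x) :
    Tendsto (fun k : ℝ => ∫ x, exp (I * (k * φ x : ℝ)) * (F x : ℂ)) atTop (𝓝 0) := by
  -- The integral is the Fourier transform of the image of `F dx` under `φ`. The null-set hypothesis
  -- makes this image absolutely continuous, so the one-dimensional Riemann-Lebesgue lemma applies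
  -- to its density, at frequency `-k / (2π)` in the normalisation of `Real.fourierChar`.
  set μF : Measure R3 := volume.withDensity fun x => ENNReal.ofReal (F x) with hμF
  have hfin : IsFiniteMeasure μF := isFiniteMeasure_withDensity_ofReal hF.2
  set ν : Measure ℝ := μF.map φ with hν
  have hac : ν ≪ volume := by
    refine Measure.AbsolutelyContinuous.mk fun Z hZm hZ => ?_
    rw [hν, Measure.map_apply hφ hZm]
    exact withDensity_absolutelyContinuous _ _ (hnull Z hZm hZ)
  have hkey : ∀ k : ℝ, ∫ x, exp (I * (k * φ x : ℝ)) * (F x : ℂ)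
      = ∫ v : ℝ, Real.fourierChar (-(v * (-k / (2 * Real.pi)))) •
          ((ν.rnDeriv volume v).toReal : ℂ) := by
    intro k
    have h1 : ∫ x, exp (I * (k * φ x : ℝ)) * (F x : ℂ) = ∫ x, exp (I * (k * φ x : ℝ)) ∂μF := by
      rw [hμF, integral_withDensity_eq_integral_toReal_smul₀
        (hF.1.aemeasurable.ennreal_ofReal) (by simp)]
      refine integral_congr_ae (Eventually.of_forall fun x => ?_)
      simp only [ENNReal.toReal_ofReal (hF0 x), Complex.real_smul]
      ring
    have h2 : ∫ x, exp (I * (k * φ x : ℝ)) ∂μF = ∫ v, exp (I * (k * v : ℝ)) ∂ν := by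
      rw [hν, integral_map hφ.aemeasurable]
      exact (by fun_prop : Continuous fun v : ℝ => exp (I * (k * v : ℝ))).aestronglyMeasurable
    rw [h1, h2, ← integral_rnDeriv_smul hac]
    refine integral_congr_ae (Eventually.of_forall fun v => ?_)
    simp only [Circle.smul_def, Real.fourierChar_apply, smul_eq_mul, Complex.real_smul]
    rw [mul_comm]
    congr 2
    have : (Real.pi : ℂ) ≠ 0 := by exact_mod_cast Real.pi_ne_zero
    push_cast
    field_simp
  simp_rw [hkey]
  have hRL := Real.tendsto_integral_exp_smul_cocompact
    (fun v => ((ν.rnDeriv volume v).toReal : ℂ))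
  refine hRL.comp ?_
  refine Tendsto.mono_right ?_ atBot_le_cocompact
  exact (tendsto_neg_atTop_atBot).atBot_div_const (by positivity)

end OscillatoryIntegrals

/-! ### Hilbert-Schmidt operators and the A* A estimate. -/

section HilbertSchmidt

variable {X Y : Type*} [MeasurableSpace X] [MeasurableSpace Y] {μ : Measure X} {ν : Measure Y}

/-- The Cauchy-Schwarz inequality for the lower Lebesgue integral. -/
theorem lintegral_mul_sq_le {f g : X → ENNReal} (hf : AEMeasurable f μ) (hg : AEMeasurable g μ) :
    (∫⁻ x, f x * g x ∂μ) ^ 2 ≤ (∫⁻ x, f x ^ 2 ∂μ) * ∫⁻ x, g x ^ 2 ∂μ := by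
  have h := ENNReal.lintegral_mul_le_Lp_mul_Lq μ Real.HolderConjugate.two_two hf hg
  calc (∫⁻ x, f x * g x ∂μ) ^ 2
      ≤ ((∫⁻ x, f x ^ (2 : ℝ) ∂μ) ^ (1 / (2 : ℝ)) * (∫⁻ x, g x ^ (2 : ℝ) ∂μ) ^ (1 / (2 : ℝ))) ^ 2 :=
        pow_le_pow_left₀ zero_le h 2
    _ = _ := by
        rw [mul_pow, ← ENNReal.rpow_natCast, ← ENNReal.rpow_mul, ← ENNReal.rpow_natCast,
          ← ENNReal.rpow_mul]
        norm_num

theorem enorm_integral_mul_sq_le {f g : X → ℂ} (hf : AEStronglyMeasurable f μ)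
    (hg : AEStronglyMeasurable g μ) :
    ‖∫ x, f x * g x ∂μ‖ₑ ^ 2 ≤ (∫⁻ x, ‖f x‖ₑ ^ 2 ∂μ) * ∫⁻ x, ‖g x‖ₑ ^ 2 ∂μ := by
  refine le_trans ?_ (lintegral_mul_sq_le hf.enorm hg.enorm)
  refine pow_le_pow_left₀ zero_le ?_ 2
  refine (enorm_integral_le_lintegral_enorm _).trans (le_of_eq ?_)
  simp_rw [enorm_mul]

theorem memLp_two_iff_lintegral {f : X → ℂ} :
    MemLp f 2 μ ↔ AEStronglyMeasurable f μ ∧ ∫⁻ x, ‖f x‖ₑ ^ 2 ∂μ ≠ ⊤ := by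
  rw [MemLp, and_congr_right_iff]
  intro _
  rw [eLpNorm_lt_top_iff_lintegral_rpow_enorm_lt_top (by norm_num) (by norm_num), lt_top_iff_ne_top]
  norm_num

theorem enorm_toLp_sq {f : X → ℂ} (hf : MemLp f 2 μ) :
    ‖hf.toLp f‖ₑ ^ 2 = ∫⁻ x, ‖f x‖ₑ ^ 2 ∂μ := by
  rw [Lp.enorm_toLp, eLpNorm_eq_lintegral_rpow_enorm_toReal (by norm_num) (by norm_num),
    ← ENNReal.rpow_natCast, ← ENNReal.rpow_mul]
  norm_num

theorem enorm_Lp_sq (u : Lp ℂ 2 μ) : ‖u‖ₑ ^ 2 = ∫⁻ x, ‖u x‖ₑ ^ 2 ∂μ := by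
  rw [← enorm_toLp_sq (Lp.memLp u), Lp.toLp_coeFn]

theorem integrable_mul_of_lintegral {f g : X → ℂ} (hf : AEStronglyMeasurable f μ)
    (hg : AEStronglyMeasurable g μ) (hf' : ∫⁻ x, ‖f x‖ₑ ^ 2 ∂μ ≠ ⊤)
    (hg' : ∫⁻ x, ‖g x‖ₑ ^ 2 ∂μ ≠ ⊤) : Integrable (fun x => f x * g x) μ :=
  (memLp_two_iff_lintegral.2 ⟨hf, hf'⟩).integrable_mul (memLp_two_iff_lintegral.2 ⟨hg, hg'⟩)

/-- A square-integrable kernel. -/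
structure IsHSKernel (μ : Measure X) (ν : Measure Y) (K : X → Y → ℂ) : Prop where
  measurable : Measurable (Function.uncurry K)
  lintegral_ne_top : ∫⁻ x, ∫⁻ y, ‖K x y‖ₑ ^ 2 ∂ν ∂μ ≠ ⊤

namespace IsHSKernel

variable {K : X → Y → ℂ}

theorem measurable_left (hK : IsHSKernel μ ν K) (x : X) : Measurable (K x) :=
  hK.measurable.comp measurable_prodMk_left

theorem measurable_right (hK : IsHSKernel μ ν K) (y : Y) : Measurable fun x => K x y :=
  hK.measurable.comp measurable_prodMk_right

theorem measurable_gramIntegrand (hK : IsHSKernel μ ν K) :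
    Measurable fun q : X × (Y × Y) => (starRingEnd ℂ) (K q.1 q.2.1) * K q.1 q.2.2 := by
  have h1 : Measurable fun q : X × (Y × Y) => K q.1 q.2.1 :=
    hK.measurable.comp (measurable_fst.prodMk (measurable_fst.comp measurable_snd))
  have h2 : Measurable fun q : X × (Y × Y) => K q.1 q.2.2 :=
    hK.measurable.comp (measurable_fst.prodMk (measurable_snd.comp measurable_snd))
  exact (Complex.continuous_conj.measurable.comp h1).mul h2

/-- The kernel of `A* A`, where `A` is the integral operator with kernel `K`. -/
def _root_.FarField.gramKernel (μ : Measure X) (K : X → Y → ℂ) (p : Y × Y) : ℂ :=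
  ∫ x, (starRingEnd ℂ) (K x p.1) * K x p.2 ∂μ

theorem stronglyMeasurable_gramKernel [SFinite μ] (hK : IsHSKernel μ ν K) :
    StronglyMeasurable (gramKernel μ K) :=
  StronglyMeasurable.integral_prod_left' hK.measurable_gramIntegrand.stronglyMeasurable

/-- Cauchy-Schwarz in `x`. For the resolvent kernel the right-hand side is independent of `k` and
serves as the dominating function as `k → ∞`. -/
theorem enorm_gramKernel_sq_le (hK : IsHSKernel μ ν K) (p : Y × Y) :
    ‖gramKernel μ K p‖ₑ ^ 2
      ≤ (∫⁻ x, ‖K x p.1‖ₑ ^ 2 ∂μ) * ∫⁻ x, ‖K x p.2‖ₑ ^ 2 ∂μ := by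
  have h := enorm_integral_mul_sq_le (μ := μ) (f := fun x => (starRingEnd ℂ) (K x p.1))
    (g := fun x => K x p.2)
    ((Complex.continuous_conj.measurable.comp (hK.measurable_right p.1)).aestronglyMeasurable)
    (hK.measurable_right p.2).aestronglyMeasurable
  simpa [gramKernel, RCLike.enorm_conj] using h

variable [SFinite ν]

theorem ae_ne_top (hK : IsHSKernel μ ν K) : ∀ᵐ x ∂μ, ∫⁻ y, ‖K x y‖ₑ ^ 2 ∂ν ≠ ⊤ := by
  filter_upwards [ae_lt_top (Measurable.lintegral_prod_right'
    (f := fun p : X × Y => ‖K p.1 p.2‖ₑ ^ 2) (hK.measurable.enorm.pow_const 2))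
    hK.lintegral_ne_top] with x hx using hx.ne

theorem aestronglyMeasurable_apply (hK : IsHSKernel μ ν K) {u : Y → ℂ}
    (hu : AEStronglyMeasurable u ν) :
    AEStronglyMeasurable (fun x => ∫ y, K x y * u y ∂ν) μ := by
  refine AEStronglyMeasurable.integral_prod_right' (f := fun p : X × Y => K p.1 p.2 * u p.2) ?_
  exact hK.measurable.aestronglyMeasurable.mul hu.comp_snd

theorem lintegral_apply_le (hK : IsHSKernel μ ν K) {u : Y → ℂ}
    (hu : AEStronglyMeasurable u ν) :
    ∫⁻ x, ‖∫ y, K x y * u y ∂ν‖ₑ ^ 2 ∂μ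
      ≤ (∫⁻ x, ∫⁻ y, ‖K x y‖ₑ ^ 2 ∂ν ∂μ) * ∫⁻ y, ‖u y‖ₑ ^ 2 ∂ν := by
  rw [← lintegral_mul_const'' _ (Measurable.lintegral_prod_right'
    (f := fun p : X × Y => ‖K p.1 p.2‖ₑ ^ 2) (hK.measurable.enorm.pow_const 2)).aemeasurable]
  exact lintegral_mono fun x =>
    enorm_integral_mul_sq_le (hK.measurable_left x).aestronglyMeasurable hu

theorem memLp_apply (hK : IsHSKernel μ ν K) {u : Y → ℂ} (hu : MemLp u 2 ν) :
    MemLp (fun x => ∫ y, K x y * u y ∂ν) 2 μ := by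
  have hu' := memLp_two_iff_lintegral.1 hu
  exact memLp_two_iff_lintegral.2 ⟨hK.aestronglyMeasurable_apply hu'.1,
    ne_top_of_le_ne_top (ENNReal.mul_ne_top hK.lintegral_ne_top hu'.2)
      (hK.lintegral_apply_le hu'.1)⟩

/-- The integral operator with a square-integrable kernel. -/
def toCLM (hK : IsHSKernel μ ν K) : Lp ℂ 2 ν →L[ℂ] Lp ℂ 2 μ :=
  LinearMap.mkContinuous
    { toFun := fun u => (hK.memLp_apply (Lp.memLp u)).toLp _
      map_add' := by
        intro u v
        rw [← MemLp.toLp_add, MemLp.toLp_eq_toLp_iff]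
        -- Splitting the integral of a sum requires `K x` to be in L², which holds for almost every
        -- `x`.
        filter_upwards [hK.ae_ne_top] with x hx
        have hi : ∀ w : Lp ℂ 2 ν, Integrable (fun y => K x y * w y) ν := fun w =>
          integrable_mul_of_lintegral (hK.measurable_left x).aestronglyMeasurable
            (Lp.aestronglyMeasurable w) hx (memLp_two_iff_lintegral.1 (Lp.memLp w)).2
        rw [Pi.add_apply, ← integral_add (hi u) (hi v)]
        refine integral_congr_ae ?_
        filter_upwards [Lp.coeFn_add u v] with y hy
        rw [hy, Pi.add_apply, mul_add]
      map_smul' := by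
        intro c u
        rw [RingHom.id_apply, ← MemLp.toLp_const_smul, MemLp.toLp_eq_toLp_iff]
        refine Eventually.of_forall fun x => ?_
        rw [Pi.smul_apply, ← integral_smul]
        refine integral_congr_ae ?_
        filter_upwards [Lp.coeFn_smul c u] with y hy
        rw [hy, Pi.smul_apply, smul_eq_mul, smul_eq_mul]
        ring }
    (Real.sqrt (∫⁻ x, ∫⁻ y, ‖K x y‖ₑ ^ 2 ∂ν ∂μ).toReal) (by
      intro u
      have h := hK.lintegral_apply_le (Lp.aestronglyMeasurable u)
      rw [← enorm_toLp_sq (hK.memLp_apply (Lp.memLp u)), ← enorm_Lp_sq] at h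
      have h' := ENNReal.toReal_mono (ENNReal.mul_ne_top hK.lintegral_ne_top (by finiteness)) h
      rw [ENNReal.toReal_mul, ENNReal.toReal_pow, ENNReal.toReal_pow, toReal_enorm,
        toReal_enorm] at h'
      refine le_of_sq_le_sq ?_ (by positivity)
      rw [mul_pow, Real.sq_sqrt ENNReal.toReal_nonneg]
      exact h')

theorem coeFn_toCLM (hK : IsHSKernel μ ν K) (u : Lp ℂ 2 ν) :
    hK.toCLM u =ᵐ[μ] fun x => ∫ y, K x y * u y ∂ν :=
  MemLp.coeFn_toLp (hK.memLp_apply (Lp.memLp u))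

variable [SFinite μ]

/-- The `A* A` estimate for an integral operator. -/
theorem lintegral_apply_sq_le (hK : IsHSKernel μ ν K) {u : Y → ℂ} (hu : MemLp u 2 ν) :
    (∫⁻ x, ‖∫ y, K x y * u y ∂ν‖ₑ ^ 2 ∂μ) ^ 2
      ≤ (∫⁻ y, ‖u y‖ₑ ^ 2 ∂ν) ^ 2 * ∫⁻ p, ‖gramKernel μ K p‖ₑ ^ 2 ∂(ν.prod ν) := by
  obtain ⟨hum, huf⟩ := memLp_two_iff_lintegral.1 hu
  set A : X → ℂ := fun x => ∫ y, K x y * u y ∂ν with hA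
  have hAL := hK.memLp_apply hu
  -- `H` is the integrand of `‖A u‖²` written as a triple integral. Fubini pairs `ū ⊗ u` with the
  -- Gram kernel, and Cauchy-Schwarz on `Y × Y` finishes.
  set H : X × (Y × Y) → ℂ := fun q =>
    ((starRingEnd ℂ) (K q.1 q.2.1 * u q.2.1)) * (K q.1 q.2.2 * u q.2.2) with hH
  have hHm : AEStronglyMeasurable H (μ.prod (ν.prod ν)) := by
    have h1 : AEStronglyMeasurable (fun q : X × (Y × Y) => u q.2.1) (μ.prod (ν.prod ν)) :=
      (hum.comp_fst (ν := ν)).comp_snd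
    have h2 : AEStronglyMeasurable (fun q : X × (Y × Y) => u q.2.2) (μ.prod (ν.prod ν)) :=
      (hum.comp_snd (μ := ν)).comp_snd
    have h3 := hK.measurable_gramIntegrand.aestronglyMeasurable (μ := μ.prod (ν.prod ν))
    refine ((h3.mul (Complex.continuous_conj.comp_aestronglyMeasurable h1)).mul h2).congr ?_
    refine Eventually.of_forall fun q => ?_
    simp only [hH, Pi.mul_apply, map_mul]
    ring
  have hHi : Integrable H (μ.prod (ν.prod ν)) := by
    refine ⟨hHm, ?_⟩
    rw [HasFiniteIntegral, lintegral_prod _ hHm.enorm]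
    have hx : ∀ x, ∫⁻ p, ‖H (x, p)‖ₑ ∂(ν.prod ν) ≤
        (∫⁻ y, ‖K x y‖ₑ ^ 2 ∂ν) * ∫⁻ y, ‖u y‖ₑ ^ 2 ∂ν := by
      intro x
      have hm : AEMeasurable (fun y => ‖K x y‖ₑ * ‖u y‖ₑ) ν :=
        (hK.measurable_left x).enorm.aemeasurable.mul hum.enorm
      have h1 : ∫⁻ p, ‖H (x, p)‖ₑ ∂(ν.prod ν) = (∫⁻ y, ‖K x y‖ₑ * ‖u y‖ₑ ∂ν) ^ 2 := by
        rw [sq, ← lintegral_prod_mul hm hm]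
        refine lintegral_congr fun p => ?_
        simp only [hH, enorm_mul, RCLike.enorm_conj]
      rw [h1]
      exact lintegral_mul_sq_le (hK.measurable_left x).enorm.aemeasurable hum.enorm
    refine lt_of_le_of_lt (lintegral_mono hx) ?_
    rw [lintegral_mul_const'' _ (Measurable.lintegral_prod_right'
      (f := fun p : X × Y => ‖K p.1 p.2‖ₑ ^ 2) (hK.measurable.enorm.pow_const 2)).aemeasurable]
    exact ENNReal.mul_lt_top hK.lintegral_ne_top.lt_top huf.lt_top
  have hleft : ∀ x, ∫ p, H (x, p) ∂(ν.prod ν) = (starRingEnd ℂ) (A x) * A x := by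
    intro x
    rw [hA]
    simp only
    rw [← integral_conj, ← integral_prod_mul]
  have hright : ∀ p : Y × Y, ∫ x, H (x, p) ∂μ
      = (starRingEnd ℂ) (u p.1) * u p.2 * gramKernel μ K p := by
    intro p
    rw [gramKernel, ← integral_const_mul]
    refine integral_congr_ae (Eventually.of_forall fun x => ?_)
    simp only [hH, map_mul]
    ring
  have hswap := integral_integral_swap (f := fun x p => H (x, p)) hHi
  simp_rw [hleft, hright] at hswap
  have hself : ∫⁻ x, ‖A x‖ₑ ^ 2 ∂μ = ‖∫ x, (starRingEnd ℂ) (A x) * A x ∂μ‖ₑ := by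
    have h1 : ∀ x, (starRingEnd ℂ) (A x) * A x = ((‖A x‖ ^ 2 : ℝ) : ℂ) := by
      intro x
      rw [Complex.conj_mul']
      norm_cast
    simp_rw [h1]
    rw [integral_complex_ofReal, ← ofReal_norm, Complex.norm_real, Real.norm_eq_abs,
      abs_of_nonneg (integral_nonneg fun x => by positivity),
      ofReal_integral_eq_lintegral_ofReal hAL.norm.integrable_sq
        (Eventually.of_forall fun x => by positivity)]
    refine lintegral_congr fun x => ?_
    rw [ENNReal.ofReal_pow (norm_nonneg _), ofReal_norm]
  rw [hself, hswap]
  have hum2 : AEStronglyMeasurable (fun p : Y × Y => (starRingEnd ℂ) (u p.1) * u p.2)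
      (ν.prod ν) :=
    (Complex.continuous_conj.comp_aestronglyMeasurable (hum.comp_fst (ν := ν))).mul
      (hum.comp_snd (μ := ν))
  refine (enorm_integral_mul_sq_le hum2
    hK.stronglyMeasurable_gramKernel.aestronglyMeasurable).trans (le_of_eq ?_)
  congr 1
  rw [sq, ← lintegral_prod_mul (hum.enorm.pow_const 2) (hum.enorm.pow_const 2)]
  refine lintegral_congr fun p => ?_
  rw [enorm_mul, mul_pow, RCLike.enorm_conj]

/-- The fourth power reflects `‖A‖⁴ = ‖A* A‖² ≤ ‖A* A‖²_HS`. -/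
theorem norm_toCLM_le (hK : IsHSKernel μ ν K) {δ : ℝ} (hδ : 0 ≤ δ)
    (h : ∫⁻ p, ‖gramKernel μ K p‖ₑ ^ 2 ∂(ν.prod ν) ≤ ENNReal.ofReal (δ ^ 4)) :
    ‖hK.toCLM‖ ≤ δ := by
  refine ContinuousLinearMap.opNorm_le_bound _ hδ fun u => ?_
  have h1 := hK.lintegral_apply_sq_le (Lp.memLp u)
  have h2 : ∫⁻ x, ‖∫ y, K x y * u y ∂ν‖ₑ ^ 2 ∂μ = ‖hK.toCLM u‖ₑ ^ 2 :=
    (enorm_toLp_sq (hK.memLp_apply (Lp.memLp u))).symm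
  rw [h2, ← enorm_Lp_sq, ← pow_mul, ← pow_mul] at h1
  have h3 := h1.trans (mul_le_mul_right h _)
  have h4 := ENNReal.toReal_mono (by finiteness) h3
  rw [ENNReal.toReal_mul, ENNReal.toReal_pow, ENNReal.toReal_pow, toReal_enorm, toReal_enorm,
    ENNReal.toReal_ofReal (by positivity), ← mul_pow, mul_comm] at h4
  rw [mul_comm]
  exact (pow_le_pow_iff_left₀ (norm_nonneg _) (by positivity) (by norm_num)).1 h4

end IsHSKernel

end HilbertSchmidt

/-! ### The Lippmann-Schwinger equation at high frequency. -/

section LippmannSchwinger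

variable {V : R3 → ℂ} {ε : ℝ}

/-- The weight `⟨x⟩^{1/2+ε} V(x)`. -/
def weightedPotential (V : R3 → ℂ) (ε : ℝ) (x : R3) : ℂ :=
  ((japanese x ^ (1 / 2 + ε) : ℝ) : ℂ) * V x

/-- The kernel of `V R_k` on `L²_{1/2+ε}`, conjugated to an operator on `L²`. -/
def resolventKernel (V : R3 → ℂ) (ε k : ℝ) (x y : R3) : ℂ :=
  weightedPotential V ε x * (fundSol k x y * ((japanese y ^ (-(1 / 2 + ε)) : ℝ) : ℂ))

theorem japanese_rpow_mul_neg (x : R3) (s : ℝ) :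
    ((japanese x ^ s : ℝ) : ℂ) * ((japanese x ^ (-s) : ℝ) : ℂ) = 1 := by
  rw [← Complex.ofReal_mul, ← Real.rpow_add (japanese_pos x)]
  simp

theorem norm_ofReal_japanese_rpow (x : R3) (s : ℝ) :
    ‖((japanese x ^ s : ℝ) : ℂ)‖ = japanese x ^ s := by
  rw [Complex.norm_real, Real.norm_eq_abs, abs_of_nonneg (Real.rpow_nonneg (japanese_pos x).le _)]

theorem continuous_ofReal_japanese_rpow (s : ℝ) :
    Continuous fun x => ((japanese x ^ s : ℝ) : ℂ) :=
  Complex.continuous_ofReal.comp (continuous_japanese_rpow s)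

theorem memWeightedLp_iff {s : ℝ} {p : ENNReal} {h : R3 → ℂ} :
    MemWeightedLp s p h ↔ MemLp (fun x => ((japanese x ^ s : ℝ) : ℂ) * h x) p volume := by
  simp only [MemWeightedLp, Complex.real_smul]

theorem AdmissiblePotential.continuous (hV : AdmissiblePotential V ε) : Continuous V :=
  hV.contDiff.continuous

theorem AdmissiblePotential.continuous_weightedPotential (hV : AdmissiblePotential V ε) :
    Continuous (weightedPotential V ε) :=
  (continuous_ofReal_japanese_rpow _).mul hV.continuous

theorem AdmissiblePotential.memLp_weightedPotential (hV : AdmissiblePotential V ε) :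
    MemLp (weightedPotential V ε) 2 volume := by
  refine (memWeightedLp_iff.1 hV.memL2).mono
    hV.continuous_weightedPotential.aestronglyMeasurable (Eventually.of_forall fun x => ?_)
  rw [weightedPotential, norm_mul, norm_mul, norm_ofReal_japanese_rpow, norm_ofReal_japanese_rpow]
  gcongr
  · exact one_le_japanese x
  · norm_num

theorem AdmissiblePotential.isHSKernel (hV : AdmissiblePotential V ε) (hε : 0 < ε) (k : ℝ) :
    IsHSKernel volume volume (resolventKernel V ε k) where
  measurable := by
    have h1 := hV.continuous_weightedPotential.measurable
    have h2 := (continuous_ofReal_japanese_rpow (-(1 / 2 + ε))).measurable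
    exact (h1.comp measurable_fst).mul ((measurable_fundSol k).mul (h2.comp measurable_snd))
  lintegral_ne_top := by
    obtain ⟨C, hC, h⟩ := exists_lintegral_fundSol_le (s := 1 / 2 + ε) (by linarith)
    have h1 : ∀ x, ∫⁻ y, ‖resolventKernel V ε k x y‖ₑ ^ 2
        ≤ ‖weightedPotential V ε x‖ₑ ^ 2 * C := by
      intro x
      simp_rw [resolventKernel, enorm_mul (weightedPotential V ε x), mul_pow]
      rw [lintegral_const_mul' _ _ (by finiteness)]
      gcongr
      exact h k x
    refine ne_top_of_le_ne_top ?_ (lintegral_mono h1)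
    rw [lintegral_mul_const' _ _ hC]
    exact ENNReal.mul_ne_top (memLp_two_iff_lintegral.1 hV.memLp_weightedPotential).2 hC

theorem norm_resolventKernel (k : ℝ) (x y : R3) :
    ‖resolventKernel V ε k x y‖ = ‖resolventKernel V ε 0 x y‖ := by
  simp only [resolventKernel, norm_mul, norm_fundSol]

/-- The argument of `V x` cancels in the product, which leaves a unimodular oscillation times a
nonnegative amplitude independent of `k`, as `tendsto_integral_exp_phase` requires. -/
theorem conj_mul_resolventKernel (k : ℝ) (x y z : R3) :
    (starRingEnd ℂ) (resolventKernel V ε k x y) * resolventKernel V ε k x z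
      = exp (I * ((k * (‖x - z‖ - ‖x - y‖) : ℝ) : ℂ)) *
        ((‖resolventKernel V ε 0 x y‖ * ‖resolventKernel V ε 0 x z‖ : ℝ) : ℂ) := by
  have hexp : exp (I * ((k * (‖x - z‖ - ‖x - y‖) : ℝ) : ℂ))
      = (starRingEnd ℂ) (exp (I * ((k * ‖x - y‖ : ℝ) : ℂ))) * exp (I * ((k * ‖x - z‖ : ℝ) : ℂ)) := by
    rw [← Complex.exp_conj, ← Complex.exp_add]
    congr 1
    rw [map_mul, Complex.conj_I, Complex.conj_ofReal]
    push_cast; ring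
  have hs : (starRingEnd ℂ) (weightedPotential V ε x) * weightedPotential V ε x
      = ((‖weightedPotential V ε x‖ : ℝ) : ℂ) * ((‖weightedPotential V ε x‖ : ℝ) : ℂ) := by
    rw [Complex.conj_mul']; ring
  simp only [resolventKernel, norm_mul, norm_fundSol, norm_ofReal_japanese_rpow, hexp]
  simp only [fundSol, map_mul, map_div₀, Complex.conj_ofReal]
  push_cast
  linear_combination (
    (starRingEnd ℂ) (exp (I * (k * ‖x - y‖))) * exp (I * (k * ‖x - z‖))
    * (4 * Real.pi * ‖x - y‖ : ℂ)⁻¹ * (4 * Real.pi * ‖x - z‖ : ℂ)⁻¹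
    * ((japanese y ^ (-(1 / 2 + ε)) : ℝ) : ℂ) * ((japanese z ^ (-(1 / 2 + ε)) : ℝ) : ℂ)) * hs

/-- The Hilbert-Schmidt norm of `A* A`, where `A` is conjugated to `V R_k`, tends to zero at high
frequency. -/
theorem AdmissiblePotential.tendsto_lintegral_gramKernel (hV : AdmissiblePotential V ε)
    (hε : 0 < ε) :
    Tendsto (fun k => ∫⁻ p, ‖gramKernel volume (resolventKernel V ε k) p‖ₑ ^ 2
      ∂((volume : Measure R3).prod volume)) atTop (𝓝 0) := by
  set κ : R3 → ENNReal := fun y => ∫⁻ x, ‖resolventKernel V ε 0 x y‖ₑ ^ 2 with hκ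
  have hK := hV.isHSKernel hε
  have hκm : Measurable κ := Measurable.lintegral_prod_left'
    (f := fun p : R3 × R3 => ‖resolventKernel V ε 0 p.1 p.2‖ₑ ^ 2)
    ((hK 0).measurable.enorm.pow_const 2)
  have hκk : ∀ k y, ∫⁻ x, ‖resolventKernel V ε k x y‖ₑ ^ 2 = κ y := fun k y => by
    refine lintegral_congr fun x => ?_
    rw [← ofReal_norm, norm_resolventKernel, ofReal_norm]
  have hκi : ∫⁻ y, κ y ≠ ⊤ := by
    rw [hκ, lintegral_lintegral_swap]
    · exact (hK 0).lintegral_ne_top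
    · exact ((hK 0).measurable.comp measurable_swap).enorm.pow_const 2 |>.aemeasurable
  have hκfin : ∀ᵐ y, κ y < ⊤ := ae_lt_top hκm hκi
  have h0 : (0 : ENNReal) = ∫⁻ _ : R3 × R3, 0 ∂((volume : Measure R3).prod volume) := by simp
  rw [h0]
  refine tendsto_lintegral_filter_of_dominated_convergence (fun p => κ p.1 * κ p.2)
    (Eventually.of_forall fun k => ?_) (Eventually.of_forall fun k => ?_) ?_ ?_
  · exact (hK k).stronglyMeasurable_gramKernel.measurable.enorm.pow_const 2
  · refine Eventually.of_forall fun p => ?_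
    have := (hK k).enorm_gramKernel_sq_le p
    rwa [hκk, hκk] at this
  · rw [lintegral_prod_mul hκm.aemeasurable hκm.aemeasurable]
    exact ENNReal.mul_ne_top hκi hκi
  -- On the diagonal the phase vanishes identically, but the diagonal is null. Off it, finiteness of
  -- `κ` at both points makes the amplitude integrable.
  · have hne : ∀ᵐ p ∂((volume : Measure R3).prod volume), p.1 ≠ p.2 := by
      rw [ae_iff]
      have hd : MeasurableSet {p : R3 × R3 | ¬ p.1 ≠ p.2} := by
        simpa using measurableSet_eq_fun measurable_fst measurable_snd
      rw [Measure.measure_prod_null hd]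
      refine Eventually.of_forall fun x => ?_
      have : Prod.mk x ⁻¹' {p : R3 × R3 | ¬ p.1 ≠ p.2} = {x} := by
        ext y; simp [eq_comm]
      simp only [this, measure_singleton, Pi.zero_apply]
    filter_upwards [hne, Measure.quasiMeasurePreserving_fst.ae hκfin,
      Measure.quasiMeasurePreserving_snd.ae hκfin] with p hp h1 h2
    have hmeas : ∀ y, AEStronglyMeasurable (fun x => resolventKernel V ε 0 x y) volume :=
      fun y => ((hK 0).measurable_right y).aestronglyMeasurable
    have hF : Integrable fun x => ‖resolventKernel V ε 0 x p.1‖ * ‖resolventKernel V ε 0 x p.2‖ := by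
      have := (integrable_mul_of_lintegral (hmeas p.1) (hmeas p.2) h1.ne h2.ne).norm
      simpa only [norm_mul] using this
    have hRL := tendsto_integral_exp_phase (φ := fun x => ‖x - p.2‖ - ‖x - p.1‖) (by fun_prop)
      (fun Z hZm hZ => volume_preimage_norm_sub_norm hp hZm hZ) hF (fun x => by positivity)
    have heq : ∀ k : ℝ, gramKernel volume (resolventKernel V ε k) p
        = ∫ x, exp (I * ((k * (‖x - p.2‖ - ‖x - p.1‖) : ℝ) : ℂ)) *
          ((‖resolventKernel V ε 0 x p.1‖ * ‖resolventKernel V ε 0 x p.2‖ : ℝ) : ℂ) := fun k =>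
      integral_congr_ae (Eventually.of_forall fun x => conj_mul_resolventKernel k x p.1 p.2)
    simp_rw [heq]
    have h3 := (continuous_enorm.tendsto (0 : ℂ)).comp hRL
    rw [enorm_zero] at h3
    have h4 := ENNReal.Tendsto.pow (n := 2) h3
    simpa using h4

/-- At high frequency, `V R_k` is a contraction of `L²_{1/2+ε}`. -/
theorem AdmissiblePotential.exists_norm_toCLM_lt_one (hV : AdmissiblePotential V ε)
    (hε : 0 < ε) : ∃ k₀ : ℝ, 0 < k₀ ∧ ∀ k, k₀ < k → ‖(hV.isHSKernel hε k).toCLM‖ < 1 := by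
  have h := (hV.tendsto_lintegral_gramKernel hε).eventually
    (gt_mem_nhds (show (0 : ENNReal) < ENNReal.ofReal ((1 / 2) ^ 4) by positivity))
  obtain ⟨k₀, hk₀⟩ := Filter.eventually_atTop.1 h
  refine ⟨max k₀ 1, by positivity, fun k hk => ?_⟩
  refine lt_of_le_of_lt ((hV.isHSKernel hε k).norm_toCLM_le (δ := 1 / 2) (by norm_num) ?_)
    (by norm_num)
  exact (hk₀ k ((le_max_left _ _).trans hk.le)).le

/-- The locally integrable function representing `R_k T` is unique. -/
theorem IsResolventOf.ae_eq {k : ℝ} {T : 𝓢'(R3, ℂ)} {w w' : R3 → ℂ} (hw : IsResolventOf k T w)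
    (hw' : IsResolventOf k T w') : w =ᵐ[volume] w' := by
  refine ae_eq_of_integral_contDiff_smul_eq hw.1 hw'.1 fun g hg hgc => ?_
  have hcs : HasCompactSupport fun x => ((g x : ℝ) : ℂ) := hgc.comp_left (g := Complex.ofReal) rfl
  have hsm : ContDiff ℝ (⊤ : ℕ∞) fun x => ((g x : ℝ) : ℂ) := Complex.ofRealCLM.contDiff.comp hg
  have h1 := hw.2 (hcs.toSchwartzMap hsm) hcs
  have h2 := hw'.2 (hcs.toSchwartzMap hsm) hcs
  have h3 := h1.trans h2.symm
  simp only [HasCompactSupport.toSchwartzMap_toFun] at h3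
  simpa only [Complex.real_smul, mul_comm] using h3

variable {k : ℝ}

theorem weightedPotential_mul_resolvent (x : R3) {h u : R3 → ℂ}
    (hu : ∀ᵐ y, u y = ((japanese y ^ (1 / 2 + ε) : ℝ) : ℂ) * h y) :
    weightedPotential V ε x * resolvent k h x = ∫ y, resolventKernel V ε k x y * u y := by
  rw [resolvent, ← integral_const_mul]
  refine integral_congr_ae ?_
  filter_upwards [hu] with y hy
  rw [hy, resolventKernel]
  have := japanese_rpow_mul_neg y (1 / 2 + ε)
  linear_combination (- weightedPotential V ε x * fundSol k x y * h y) * this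

/-- The resolvent of a function in `L²_{1/2+ε}` is bounded. -/
theorem exists_norm_resolvent_le (hε : 0 < ε) {h : R3 → ℂ} (hh : MemWeightedLp (1 / 2 + ε) 2 h) :
    ∃ C : ℝ, ∀ x, ‖resolvent k h x‖ ≤ C := by
  obtain ⟨C, hC, hb⟩ := exists_lintegral_fundSol_le (s := 1 / 2 + ε) (by linarith)
  rw [memWeightedLp_iff, memLp_two_iff_lintegral] at hh
  set M := ∫⁻ y, ‖((japanese y ^ (1 / 2 + ε) : ℝ) : ℂ) * h y‖ₑ ^ 2
  refine ⟨Real.sqrt (C * M).toReal, fun x => Real.le_sqrt_of_sq_le ?_⟩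
  have h1 : resolvent k h x = ∫ y, (fundSol k x y * ((japanese y ^ (-(1 / 2 + ε)) : ℝ) : ℂ)) *
      (((japanese y ^ (1 / 2 + ε) : ℝ) : ℂ) * h y) := by
    refine integral_congr_ae (Eventually.of_forall fun y => ?_)
    have := japanese_rpow_mul_neg y (1 / 2 + ε)
    simp only
    linear_combination (- fundSol k x y * h y) * this
  have hm : Measurable fun y => fundSol k x y * ((japanese y ^ (-(1 / 2 + ε)) : ℝ) : ℂ) :=
    ((measurable_fundSol k).comp measurable_prodMk_left).mul
      (continuous_ofReal_japanese_rpow _).measurable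
  have h2 := (enorm_integral_mul_sq_le hm.aestronglyMeasurable hh.1).trans
    (mul_le_mul_left (hb k x) _)
  rw [← h1] at h2
  have h3 := ENNReal.toReal_mono (ENNReal.mul_ne_top hC hh.2) h2
  rwa [ENNReal.toReal_pow, toReal_enorm] at h3

theorem exists_eq_add_apply {H : Type*} [NormedAddCommGroup H] [NormedSpace ℂ H] [CompleteSpace H]
    {A : H →L[ℂ] H} (hA : ‖A‖ < 1) (b : H) : ∃ u, u = b + A u := by
  obtain ⟨B, hB⟩ := isUnit_one_sub_of_norm_lt_one hA
  have h1 : (B.1 * (B⁻¹).1) b = b := by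
    rw [B.mul_inv]; rfl
  refine ⟨(B⁻¹).1 b, ?_⟩
  rw [hB] at h1
  exact sub_eq_iff_eq_add.1 h1

theorem eq_of_eq_add_apply {H : Type*} [NormedAddCommGroup H] [NormedSpace ℂ H]
    {A : H →L[ℂ] H} (hA : ‖A‖ < 1) {b u v : H} (hu : u = b + A u) (hv : v = b + A v) : u = v := by
  have h4 : u - v = A (u - v) := by
    rw [map_sub]
    nth_rewrite 1 [hu, hv]
    abel
  by_contra hne
  have hpos : 0 < ‖u - v‖ := norm_pos_iff.2 (sub_ne_zero.2 hne)
  have h5 := A.le_opNorm (u - v)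
  rw [← h4] at h5
  nlinarith

/-- The Lippmann-Schwinger equation is uniquely solvable when `V R_k` is a contraction. -/
theorem hasInverse_of_norm_lt_one (hV : AdmissiblePotential V ε) (hε : 0 < ε)
    (hk : ‖(hV.isHSKernel hε k).toCLM‖ < 1) {T : 𝓢'(R3, ℂ)} {w : R3 → ℂ}
    (hw : IsResolventOf k T w) (hVw : MemLp (fun x => weightedPotential V ε x * w x) 2 volume) :
    HasInverse V ε k T := by
  set A := (hV.isHSKernel hε k).toCLM with hA
  obtain ⟨u, huA⟩ := exists_eq_add_apply hk (hVw.toLp _)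
  -- Undoing the conjugation: `u = ⟨·⟩^(1/2+ε) h` solves the equation in L² exactly when `h` solves
  -- the original one.
  set h : R3 → ℂ := fun x => ((japanese x ^ (-(1 / 2 + ε)) : ℝ) : ℂ) * u x with hh
  have huh : ∀ y, u y = ((japanese y ^ (1 / 2 + ε) : ℝ) : ℂ) * h y := by
    intro y
    have := japanese_rpow_mul_neg y (1 / 2 + ε)
    rw [hh]
    simp only
    linear_combination (- u y) * this
  have hmem : MemWeightedLp (1 / 2 + ε) 2 h := by
    rw [memWeightedLp_iff]
    simp_rw [← huh]
    exact Lp.memLp u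
  refine ⟨h, ⟨hmem, w, hw, ?_⟩, ?_⟩
  · have h1 : u =ᵐ[volume] fun x => weightedPotential V ε x * w x + A u x := by
      conv_lhs => rw [huA]
      filter_upwards [Lp.coeFn_add (hVw.toLp _) (A u), hVw.coeFn_toLp] with x hx hx'
      rw [hx, Pi.add_apply, hx']
    filter_upwards [h1, (hV.isHSKernel hε k).coeFn_toCLM u] with x hx hx'
    rw [← hA] at hx'
    rw [hx', ← weightedPotential_mul_resolvent x (Eventually.of_forall huh), huh x,
      weightedPotential] at hx
    have hne : ((japanese x ^ (1 / 2 + ε) : ℝ) : ℂ) ≠ 0 := by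
      exact_mod_cast (Real.rpow_pos_of_pos (japanese_pos x) _).ne'
    refine mul_left_cancel₀ hne ?_
    rw [hx]; ring
  · rintro h' ⟨hmem', w', hw', heq'⟩
    -- A competing solution may carry another representative of `R_k T`; both agree almost
    -- everywhere, so the source term in L² is the same.
    have hww := hw'.ae_eq hw
    rw [memWeightedLp_iff] at hmem'
    set v := hmem'.toLp _ with hv
    have hvae := hmem'.coeFn_toLp
    have h2 : v = hVw.toLp _ + A v := by
      refine Lp.ext ?_
      filter_upwards [Lp.coeFn_add (hVw.toLp _) (A v), hVw.coeFn_toLp, hvae, heq', hww,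
        (hV.isHSKernel hε k).coeFn_toCLM v] with x h1 h2 h3 h4 h5 h6
      rw [h1, Pi.add_apply, h2, hA, h6, ← weightedPotential_mul_resolvent x hvae, h3]
      rw [h4, h5, weightedPotential]
      ring
    have h3 : u = v := eq_of_eq_add_apply hk huA h2
    filter_upwards [hvae] with x hx
    rw [hh]
    simp only
    rw [h3, hx]
    have := japanese_rpow_mul_neg x (1 / 2 + ε)
    linear_combination (- h' x) * this

/-- The solution of the Lippmann-Schwinger equation is integrable. -/
theorem IsInverseCorrection.integrable (hV : AdmissiblePotential V ε) (hε : 0 < ε)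
    {T : 𝓢'(R3, ℂ)} {w h : R3 → ℂ} (hw : IsResolventOf k T w)
    (hw2 : MemWeightedLp (-(3 / 2 + ε)) 2 w) (hh : IsInverseCorrection V ε k T h) :
    Integrable h := by
  obtain ⟨hmem, w', hw', heq⟩ := hh
  have hVL := memWeightedLp_iff.1 hV.memL2
  -- `⟨x⟩^(3/2+ε) V` is in L², and so are `⟨x⟩^(-(3/2+ε))` and `⟨x⟩^(-(3/2+ε)) w`; thus `V` and `V
  -- w` are integrable. As `R_k h` is bounded, `V R_k h` is integrable too.
  have hV1 : Integrable V := by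
    have h1 : MemLp (fun x => ((japanese x ^ (-(3 / 2 + ε)) : ℝ) : ℂ)) 2 volume :=
      (memLp_japanese_rpow (r := 3 / 2 + ε) (by linarith)).ofReal
    refine (hVL.integrable_mul h1).congr (Eventually.of_forall fun x => ?_)
    have := japanese_rpow_mul_neg x (3 / 2 + ε)
    simp only [Pi.mul_apply]
    linear_combination V x * this
  have hVw : Integrable fun x => V x * w x := by
    refine (hVL.integrable_mul (memWeightedLp_iff.1 hw2)).congr (Eventually.of_forall fun x => ?_)
    have := japanese_rpow_mul_neg x (3 / 2 + ε)
    simp only [Pi.mul_apply]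
    linear_combination V x * w x * this
  obtain ⟨C, hC⟩ := exists_norm_resolvent_le (k := k) hε hmem
  have hmeas : AEStronglyMeasurable h volume := by
    have h1 := (continuous_ofReal_japanese_rpow (-(1 / 2 + ε))).aestronglyMeasurable (μ := volume)
      |>.mul (memWeightedLp_iff.1 hmem).1
    refine h1.congr (Eventually.of_forall fun x => ?_)
    have := japanese_rpow_mul_neg x (1 / 2 + ε)
    simp only [Pi.mul_apply]
    linear_combination h x * this
  refine (hVw.norm.add (hV1.norm.mul_const C)).mono' hmeas ?_
  filter_upwards [heq, hw'.ae_eq hw] with x h1 h2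
  rw [h1, h2, mul_add]
  refine (norm_add_le _ _).trans ?_
  simp only [Pi.add_apply]
  gcongr
  rw [norm_mul]
  gcongr
  exact hC x

theorem isInverseCorrection_inverseCorrection {T : 𝓢'(R3, ℂ)} (hT : HasInverse V ε k T) :
    IsInverseCorrection V ε k T (inverseCorrection V ε k T) := by
  rw [inverseCorrection, dif_pos hT]
  exact hT.choose_spec.1

/-- The far-field pattern of a compactly supported source is continuous. -/
theorem continuous_farField {T : 𝓢'(R3, ℂ)} {R : ℝ}
    (hT : Distribution.dsupport T ⊆ Metric.closedBall 0 R)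
    (hh : Integrable (inverseCorrection V ε k T)) : Continuous (farField V ε k T) := by
  have h1 : Continuous fun θ : R3 => ∫ y, planeWave k θ y * inverseCorrection V ε k T y := by
    refine continuous_of_dominated (bound := fun y => ‖inverseCorrection V ε k T y‖)
      (fun θ => ?_) (fun θ => ?_) hh.norm ?_
    · exact (contDiff_planeWave k θ).continuous.aestronglyMeasurable.mul hh.1
    · refine Eventually.of_forall fun y => ?_
      rw [norm_mul, norm_planeWave, one_mul]
    · refine Eventually.of_forall fun y => ?_
      have : Continuous fun θ : R3 => planeWave k θ y := by
        unfold planeWave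
        fun_prop
      exact this.mul continuous_const
  exact (continuous_const.mul ((continuous_pairSmooth_planeWave hT k).add h1)).comp
    continuous_subtype_val

end LippmannSchwinger

/-! ### Functionals that are square-summable on an orthonormal family. -/

section Hilbert

variable {X H : Type*} [AddCommGroup X] [Module ℂ X] [NormedAddCommGroup H]
  [InnerProductSpace ℂ H]

/-- Gram-Schmidt orthonormalization through an injective linear map. -/
theorem exists_orthonormal_lift (N : X →ₗ[ℂ] H) (hN : Function.Injective N) (u : ℕ → X) :
    ∃ (s : Set ℕ) (e : s → X), Orthonormal ℂ (fun i => N (e i)) ∧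
      ∀ n, u n ∈ Submodule.span ℂ (Set.range e) := by
  set v := InnerProductSpace.gramSchmidtNormed ℂ (fun n => N (u n)) with hv
  have hspan : Submodule.span ℂ (Set.range v) = Submodule.map N (Submodule.span ℂ (Set.range u)) := by
    rw [hv, InnerProductSpace.span_gramSchmidtNormed_range, InnerProductSpace.span_gramSchmidt,
      Submodule.map_span, ← Set.range_comp]
    rfl
  have hlift : ∀ n, ∃ x : X, N x = v n := by
    intro n
    have h1 : v n ∈ Submodule.span ℂ (Set.range v) := Submodule.subset_span ⟨n, rfl⟩
    rw [hspan] at h1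
    obtain ⟨x, -, hx⟩ := h1
    exact ⟨x, hx⟩
  choose e he using hlift
  -- Gram-Schmidt returns zero at each vector dependent on its predecessors; dropping those indices
  -- leaves an orthonormal family with the same span.
  refine ⟨{n | v n ≠ 0}, fun i => e i, ?_, fun n => ?_⟩
  · have := InnerProductSpace.gramSchmidtNormed_orthonormal' (𝕜 := ℂ) (fun n => N (u n))
    simp_rw [he]
    exact this
  · have h1 : N (u n) ∈ Submodule.span ℂ (Set.range v) := by
      rw [hspan]
      exact ⟨u n, Submodule.subset_span ⟨n, rfl⟩, rfl⟩
    have h2 : Submodule.span ℂ (Set.range v)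
        ≤ Submodule.map N (Submodule.span ℂ (Set.range fun i : {n | v n ≠ 0} => e i)) := by
      rw [Submodule.span_le]
      rintro _ ⟨j, rfl⟩
      by_cases hj : v j = 0
      · rw [hj]; exact Submodule.zero_mem _
      · exact ⟨e j, Submodule.subset_span ⟨⟨j, hj⟩, rfl⟩, he j⟩
    obtain ⟨x, hx, hxu⟩ := h2 h1
    rwa [← hN hxu]

/-- A functional with square-summable values on an orthonormal family is represented by a
vector. -/
theorem exists_inner_eq_of_summable [CompleteSpace H] {ι : Type*} (N : X →ₗ[ℂ] H) {e : ι → X}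
    (he : Orthonormal ℂ fun i => N (e i)) (l : X →ₗ[ℂ] ℂ)
    (hl : Summable fun i => ‖l (e i)‖ ^ 2) :
    ∃ W : H, ∀ x ∈ Submodule.span ℂ (Set.range e), inner ℂ W (N x) = l x := by
  have hsum : Summable fun i => (starRingEnd ℂ) (l (e i)) • N (e i) := by
    have h := (he.orthogonalFamily.summable_iff_norm_sq_summable
      (fun i => (starRingEnd ℂ) (l (e i)))).2 (by simpa using hl)
    exact h
  -- The coefficients are conjugated because the inner product is conjugate-linear in its first
  -- slot. As `l` need not be continuous with respect to `N`, the identity is claimed on the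
  -- algebraic span only.
  refine ⟨∑' i, (starRingEnd ℂ) (l (e i)) • N (e i), fun x hx => ?_⟩
  have hlin : Set.EqOn ((innerSL ℂ (∑' i, (starRingEnd ℂ) (l (e i)) • N (e i))).toLinearMap ∘ₗ N) l
      (Submodule.span ℂ (Set.range e)) := by
    refine LinearMap.eqOn_span' ?_
    rintro _ ⟨j, rfl⟩
    simp only [LinearMap.coe_comp, ContinuousLinearMap.coe_coe, Function.comp_apply,
      innerSL_apply_apply]
    rw [← inner_conj_symm]
    have h1 := hsum.hasSum.mapL (innerSL ℂ (N (e j)))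
    simp only [innerSL_apply_apply, inner_smul_right] at h1
    have h2 : HasSum (fun i => (starRingEnd ℂ) (l (e i)) * inner ℂ (N (e j)) (N (e i)))
        ((starRingEnd ℂ) (l (e j)) * inner ℂ (N (e j)) (N (e j))) := by
      refine hasSum_single j fun i hij => ?_
      rw [he.2 hij.symm, mul_zero]
    rw [h1.unique h2, inner_self_eq_norm_sq_to_K, he.1 j]
    simp
  exact hlin hx

end Hilbert

/-! ### Second moments of the random distribution. -/

section SecondMoment

theorem add_sq_le_two_mul (a b : ENNReal) :
    (a + b) ^ 2 ≤ 2 * (a ^ 2 + b ^ 2) := by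
  have h := ENNReal.rpow_add_le_mul_rpow_add_rpow a b (p := 2) (by norm_num)
  norm_num at h
  exact h

/-- A pseudodifferential operator of order less than `-3/2` maps `L²` to `L^∞`. -/
theorem exists_enorm_pseudoDiffOp_le {c : R3 × R3 → ℂ} {m : ℝ} (hm : 3 / 2 < m)
    (hc : Continuous c) (hb : SymbolBounds (-m) Set.univ c) :
    ∃ C : ENNReal, C ≠ ⊤ ∧ ∀ (φ : 𝓢(R3, ℂ)) (x : R3),
      ‖pseudoDiffOp c φ x‖ₑ ^ 2 ≤ C * ∫⁻ y, ‖φ y‖ₑ ^ 2 := by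
  -- The undifferentiated symbol bound suffices: `⟨ξ⟩^(-m)` is in L² for `m > 3/2`, so
  -- Cauchy-Schwarz in `ξ` and Plancherel bound the operator pointwise. The factor `|(a ^ 3)⁻¹|`
  -- comes from rescaling the frequency by `a`.
  obtain ⟨B, hB⟩ := hb 0 0
  have hB' : ∀ x ξ, ‖c (x, ξ)‖ ≤ B * japanese ξ ^ (-m) := by
    intro x ξ
    have := hB x ξ (Set.mem_univ _)
    simp only [norm_iteratedFDeriv_zero] at this
    simpa using this
  have hJ := memLp_two_iff_lintegral.1
    (((memLp_japanese_rpow hm).const_mul B).ofReal (K := ℂ))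
  set J := ∫⁻ ξ : R3, ‖((B * japanese ξ ^ (-m) : ℝ) : ℂ)‖ₑ ^ 2 with hJdef
  set a : ℝ := (2 * Real.pi)⁻¹ with ha
  have ha0 : a ≠ 0 := by positivity
  refine ⟨‖((2 * Real.pi : ℂ) ^ 3)⁻¹‖ₑ ^ 2 * (J * ENNReal.ofReal |(a ^ 3)⁻¹|),
    ENNReal.mul_ne_top (by finiteness) (ENNReal.mul_ne_top hJ.2 ENNReal.ofReal_ne_top),
    fun φ x => ?_⟩
  have hF : ∫⁻ ξ : R3, ‖𝓕 (φ : R3 → ℂ) (a • ξ)‖ₑ ^ 2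
      = ENNReal.ofReal |(a ^ 3)⁻¹| * ∫⁻ y, ‖φ y‖ₑ ^ 2 := by
    have h1 : ∀ ψ : 𝓢(R3, ℂ), ∫⁻ y, ‖ψ y‖ₑ ^ 2 = ENNReal.ofReal (∫ y, ‖ψ y‖ ^ 2) := by
      intro ψ
      rw [ofReal_integral_eq_lintegral_ofReal (ψ.memLp 2 volume).norm.integrable_sq
        (Eventually.of_forall fun y => by positivity)]
      refine lintegral_congr fun y => ?_
      rw [ENNReal.ofReal_pow (norm_nonneg _), ofReal_norm]
    have hi : Integrable fun ξ : R3 => ‖(𝓕 φ) ξ‖ ^ 2 := ((𝓕 φ).memLp 2 volume).norm.integrable_sq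
    rw [h1 φ, ← SchwartzMap.integral_norm_sq_fourier φ, ← ENNReal.ofReal_mul (abs_nonneg _)]
    have h3 := Measure.integral_comp_smul volume (fun ξ : R3 => ‖(𝓕 φ) ξ‖ ^ 2) a
    have hfin : Module.finrank ℝ R3 = 3 := by simp
    rw [hfin, smul_eq_mul] at h3
    rw [← h3, ofReal_integral_eq_lintegral_ofReal (hi.comp_smul ha0)
      (Eventually.of_forall fun y => by positivity)]
    refine lintegral_congr fun y => ?_
    rw [ENNReal.ofReal_pow (norm_nonneg _), ofReal_norm, SchwartzMap.fourier_coe]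
  have hcm : Continuous fun ξ : R3 => exp (I * (inner ℝ x ξ : ℝ)) * c (x, ξ) := by
    fun_prop
  have hFm : Continuous fun ξ : R3 => 𝓕 (φ : R3 → ℂ) (a • ξ) := by
    rw [← SchwartzMap.fourier_coe]
    exact (𝓕 φ).continuous.comp (continuous_const_smul a)
  rw [pseudoDiffOp, enorm_mul, mul_pow, mul_assoc, mul_assoc, ← hF]
  gcongr
  refine (enorm_integral_mul_sq_le hcm.aestronglyMeasurable hFm.aestronglyMeasurable).trans ?_
  gcongr
  refine lintegral_mono fun ξ => ?_
  gcongr ?_ ^ 2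
  rw [← ofReal_norm, ← ofReal_norm]
  refine ENNReal.ofReal_le_ofReal ?_
  have : I * ((inner ℝ x ξ : ℝ) : ℂ) = ((inner ℝ x ξ : ℝ) : ℂ) * I := mul_comm _ _
  rw [norm_mul, this, Complex.norm_exp_ofReal_mul_I, one_mul, Complex.norm_real]
  exact (hB' x ξ).trans (le_abs_self _)

variable {Ω : Type*} [MeasurableSpace Ω] {P : Measure Ω} [IsProbabilityMeasure P]
  {f : Ω → 𝓢'(R3, ℂ)} {D : Set R3} {m : ℝ} {μ : R3 → ℝ}

/-- The covariance form is bilinear, so its first argument must be the conjugate of `ψ` for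
`conjPair` to return the conjugate of the pairing with `ψ`. -/
theorem IsMIGR.lintegral_centredPair_sq (hf : IsMIGR P f D m μ) (ψ : 𝓢(R3, ℂ)) :
    ∫⁻ ω, ‖centredPair P f ω ψ‖ₑ ^ 2 ∂P
      = ‖covarianceForm P f (SchwartzMap.postcompCLM (conjCLE : ℂ →L[ℝ] ℂ) ψ) ψ‖ₑ := by
  have hL : MemLp (fun ω => centredPair P f ω ψ) 2 P :=
    (hf.gaussian ψ).memLp_two.sub (memLp_const _)
  have h1 : ∀ ω, conjPair (centredPair P f ω) (SchwartzMap.postcompCLM (conjCLE : ℂ →L[ℝ] ℂ) ψ) *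
      centredPair P f ω ψ = ((‖centredPair P f ω ψ‖ ^ 2 : ℝ) : ℂ) := by
    intro ω
    have h2 : SchwartzMap.postcompCLM (conjCLE : ℂ →L[ℝ] ℂ)
        (SchwartzMap.postcompCLM (conjCLE : ℂ →L[ℝ] ℂ) ψ) = ψ := by
      ext x
      simp
    rw [conjPair, h2, Complex.conj_mul']
    norm_cast
  rw [covarianceForm]
  simp_rw [h1]
  rw [integral_complex_ofReal, ← ofReal_norm, Complex.norm_real, Real.norm_eq_abs,
    abs_of_nonneg (integral_nonneg fun x => by positivity),
    ofReal_integral_eq_lintegral_ofReal hL.norm.integrable_sq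
      (Eventually.of_forall fun x => by positivity)]
  refine lintegral_congr fun x => ?_
  rw [ENNReal.ofReal_pow (norm_nonneg _), ofReal_norm]

/-- The second moments of a random distribution of order less than `-3/2` are controlled by the
`L²` norm of test functions supported in a fixed ball. -/
theorem IsMIGR.exists_lintegral_sq_le (hf : IsMIGR P f D m μ) (hm : 3 / 2 < m) (R : ℝ) :
    ∃ C : ENNReal, C ≠ ⊤ ∧ ∀ ψ : 𝓢(R3, ℂ), tsupport ψ ⊆ Metric.closedBall 0 R →
      ∫⁻ ω, ‖f ω ψ‖ₑ ^ 2 ∂P ≤ C * ∫⁻ x, ‖ψ x‖ₑ ^ 2 := by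
  obtain ⟨a, ha, hac, -, hmean⟩ := hf.mean
  obtain ⟨c, ⟨hcs, hcb, -⟩, hcov⟩ := hf.covariance
  obtain ⟨C, hC, hop⟩ := exists_enorm_pseudoDiffOp_le hm hcs.continuous hcb
  have haL := (memLp_two_iff_lintegral.1 (ha.continuous.memLp_of_hasCompactSupport
    (μ := volume) (p := 2) hac))
  set A := ∫⁻ x, ‖a x‖ₑ ^ 2
  set M := volume (Metric.closedBall (0 : R3) R)
  have hM : M ≠ ⊤ := (isCompact_closedBall (0 : R3) R).measure_ne_top
  -- `A` bounds the mean. The covariance contributes `√(C M)`, where `M` arises from `L¹ ≤ √M L²` on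
  -- the ball, and `1 + C * M` replaces the root. The 2 is from `(a + b)² ≤ 2(a² + b²)`.
  refine ⟨2 * ((1 + C * M) + A), by have := haL.2; finiteness, fun ψ hψ => ?_⟩
  set B := ∫⁻ x, ‖ψ x‖ₑ ^ 2 with hB
  have hmeanle : ‖∫ ω', f ω' ψ ∂P‖ₑ ^ 2 ≤ A * B := by
    rw [hmean]
    exact enorm_integral_mul_sq_le ha.continuous.aestronglyMeasurable
      ψ.continuous.aestronglyMeasurable
  have hL1 : (∫⁻ x, ‖ψ x‖ₑ) ^ 2 ≤ M * B := by
    have h1 : ∫⁻ x, ‖ψ x‖ₑ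
        = ∫⁻ x, (Metric.closedBall (0 : R3) R).indicator 1 x * ‖ψ x‖ₑ := by
      refine lintegral_congr fun x => ?_
      by_cases hx : x ∈ Metric.closedBall (0 : R3) R
      · rw [Set.indicator_of_mem hx, Pi.one_apply, one_mul]
      · rw [Set.indicator_of_notMem hx, zero_mul,
          image_eq_zero_of_notMem_tsupport fun h => hx (hψ h), enorm_zero]
    rw [h1]
    refine (lintegral_mul_sq_le (measurable_one.indicator measurableSet_closedBall).aemeasurable
      ψ.continuous.enorm.measurable.aemeasurable).trans ?_
    gcongr
    have h2 : ∀ x, (Metric.closedBall (0 : R3) R).indicator (1 : R3 → ENNReal) x ^ 2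
        = (Metric.closedBall (0 : R3) R).indicator 1 x := by
      intro x
      by_cases hx : x ∈ Metric.closedBall (0 : R3) R <;> simp [hx]
    simp_rw [h2]
    rw [lintegral_indicator_one measurableSet_closedBall]
  have hcentred : ∫⁻ ω, ‖centredPair P f ω ψ‖ₑ ^ 2 ∂P ≤ (1 + C * M) * B := by
    rw [hf.lintegral_centredPair_sq, hcov]
    set ψc := SchwartzMap.postcompCLM (conjCLE : ℂ →L[ℝ] ℂ) ψ with hψc
    have hψcB : ∫⁻ y, ‖ψc y‖ₑ ^ 2 = B := by
      refine lintegral_congr fun y => ?_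
      rw [hψc, SchwartzMap.postcompCLM_apply, ← ofReal_norm, ← ofReal_norm]
      simp
    have h1 : ‖∫ x, pseudoDiffOp c ψc x * ψ x‖ₑ ^ 2 ≤ C * B * (M * B) := by
      have h2 : ‖∫ x, pseudoDiffOp c ψc x * ψ x‖ₑ
          ≤ (C * B) ^ (1 / 2 : ℝ) * ∫⁻ x, ‖ψ x‖ₑ := by
        refine (enorm_integral_le_lintegral_enorm _).trans ?_
        rw [← lintegral_const_mul _ ψ.continuous.enorm.measurable]
        refine lintegral_mono fun x => ?_
        rw [enorm_mul]
        gcongr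
        have h3 := hop ψc x
        rw [hψcB] at h3
        have h4 := ENNReal.rpow_le_rpow h3 (show (0 : ℝ) ≤ 1 / 2 by norm_num)
        rwa [← ENNReal.rpow_natCast, ← ENNReal.rpow_mul, show ((2 : ℕ) : ℝ) * (1 / 2) = 1 by norm_num,
          ENNReal.rpow_one] at h4
      calc _ ≤ ((C * B) ^ (1 / 2 : ℝ) * ∫⁻ x, ‖ψ x‖ₑ) ^ 2 := by gcongr
        _ = C * B * (∫⁻ x, ‖ψ x‖ₑ) ^ 2 := by
            rw [mul_pow, ← ENNReal.rpow_natCast, ← ENNReal.rpow_mul,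
              show (1 / 2 : ℝ) * ((2 : ℕ) : ℝ) = 1 by norm_num, ENNReal.rpow_one]
        _ ≤ _ := by gcongr
    refine (ENNReal.pow_le_pow_left_iff (n := 2) (by norm_num)).1 (h1.trans ?_)
    calc C * B * (M * B) = (C * M) * 1 * B ^ 2 := by ring
      _ ≤ (1 + C * M) * (1 + C * M) * B ^ 2 := by
          gcongr
          · exact le_add_self
          · exact le_self_add
      _ = _ := by ring
  calc ∫⁻ ω, ‖f ω ψ‖ₑ ^ 2 ∂P
      ≤ ∫⁻ ω, 2 * (‖centredPair P f ω ψ‖ₑ ^ 2 + ‖∫ ω', f ω' ψ ∂P‖ₑ ^ 2) ∂P := by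
        refine lintegral_mono fun ω => ?_
        have : f ω ψ = centredPair P f ω ψ + ∫ ω', f ω' ψ ∂P := by rw [centredPair]; ring
        conv_lhs => rw [this]
        refine le_trans ?_ (add_sq_le_two_mul _ _)
        gcongr
        exact enorm_add_le _ _
    _ = 2 * (∫⁻ ω, ‖centredPair P f ω ψ‖ₑ ^ 2 ∂P + ‖∫ ω', f ω' ψ ∂P‖ₑ ^ 2) := by
        rw [lintegral_const_mul' _ _ (by finiteness), lintegral_add_right _ measurable_const]
        simp
    _ ≤ 2 * ((1 + C * M) * B + A * B) := by gcongr
    _ = _ := by ring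

end SecondMoment

/-! ### The resolvent of the random distribution as a function. -/

section RandomResolvent

/-- The space of smooth compactly supported functions. -/
def testSpace : Submodule ℂ 𝓢(R3, ℂ) where
  carrier := {φ | HasCompactSupport φ}
  add_mem' := fun hφ hψ => HasCompactSupport.add hφ hψ
  zero_mem' := HasCompactSupport.zero
  smul_mem' := fun c _ hφ => HasCompactSupport.smul_left (f := fun _ => c) hφ

theorem continuous_inv_weight {ρ : R3 → ℝ} (hρ : Continuous ρ) (hρ0 : ∀ x, 0 < ρ x) :
    Continuous fun x => (((ρ x)⁻¹ : ℝ) : ℂ) :=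
  Complex.continuous_ofReal.comp (hρ.inv₀ fun x => (hρ0 x).ne')

theorem memLp_inv_weight_mul {ρ : R3 → ℝ} (hρ : Continuous ρ) (hρ0 : ∀ x, 0 < ρ x)
    (φ : testSpace) : MemLp (fun x => (((ρ x)⁻¹ : ℝ) : ℂ) * φ.1 x) 2 volume :=
  ((continuous_inv_weight hρ hρ0).mul φ.1.continuous).memLp_of_hasCompactSupport
    (HasCompactSupport.mul_left φ.2)

/-- Division of test functions by a positive weight, as a map to `L²`. -/
def divWeight {ρ : R3 → ℝ} (hρ : Continuous ρ) (hρ0 : ∀ x, 0 < ρ x) :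
    testSpace →ₗ[ℂ] Lp ℂ 2 (volume : Measure R3) where
  toFun φ := (memLp_inv_weight_mul hρ hρ0 φ).toLp _
  map_add' φ ψ := by
    rw [← MemLp.toLp_add, MemLp.toLp_eq_toLp_iff]
    refine Eventually.of_forall fun x => ?_
    have : (φ + ψ).1 x = φ.1 x + ψ.1 x := rfl
    simp only [Pi.add_apply, this]
    ring
  map_smul' c φ := by
    rw [RingHom.id_apply, ← MemLp.toLp_const_smul, MemLp.toLp_eq_toLp_iff]
    refine Eventually.of_forall fun x => ?_
    have : (c • φ).1 x = c * φ.1 x := rfl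
    simp only [Pi.smul_apply, this, smul_eq_mul]
    ring

theorem coeFn_divWeight {ρ : R3 → ℝ} (hρ : Continuous ρ) (hρ0 : ∀ x, 0 < ρ x) (φ : testSpace) :
    divWeight hρ hρ0 φ =ᵐ[volume] fun x => (((ρ x)⁻¹ : ℝ) : ℂ) * φ.1 x :=
  (memLp_inv_weight_mul hρ hρ0 φ).coeFn_toLp

theorem divWeight_injective {ρ : R3 → ℝ} (hρ : Continuous ρ) (hρ0 : ∀ x, 0 < ρ x) :
    Function.Injective (divWeight hρ hρ0) := by
  intro φ ψ h
  have h1 : (fun x => (((ρ x)⁻¹ : ℝ) : ℂ) * φ.1 x) =ᵐ[volume]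
      fun x => (((ρ x)⁻¹ : ℝ) : ℂ) * ψ.1 x :=
    (coeFn_divWeight hρ hρ0 φ).symm.trans (h ▸ coeFn_divWeight hρ hρ0 ψ)
  have h2 := ((continuous_inv_weight hρ hρ0).mul φ.1.continuous).ae_eq_iff_eq volume
    ((continuous_inv_weight hρ hρ0).mul ψ.1.continuous) |>.1 h1
  ext x
  have hne : (((ρ x)⁻¹ : ℝ) : ℂ) ≠ 0 := by exact_mod_cast (inv_pos.2 (hρ0 x)).ne'
  exact mul_left_cancel₀ hne (congrFun h2 x)

theorem integrable_fundSol_mul (k : ℝ) (x : R3) (φ : testSpace) :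
    Integrable fun y => fundSol k x y * φ.1 y := by
  obtain ⟨C, hC, hb⟩ := exists_lintegral_fundSol_le (s := 1) (by norm_num)
  have h1 : MemLp (fun y => ((japanese y ^ (1 : ℝ) : ℝ) : ℂ) * φ.1 y) 2 volume :=
    ((continuous_ofReal_japanese_rpow 1).mul φ.1.continuous).memLp_of_hasCompactSupport
      (HasCompactSupport.mul_left φ.2)
  have h1' := memLp_two_iff_lintegral.1 h1
  have hm : Measurable fun y => fundSol k x y * ((japanese y ^ (-1 : ℝ) : ℝ) : ℂ) :=
    ((measurable_fundSol k).comp measurable_prodMk_left).mul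
      (continuous_ofReal_japanese_rpow _).measurable
  refine (integrable_mul_of_lintegral hm.aestronglyMeasurable h1'.1
    (ne_top_of_le_ne_top hC (hb k x)) h1'.2).congr (Eventually.of_forall fun y => ?_)
  have := japanese_rpow_mul_neg y 1
  simp only
  linear_combination fundSol k x y * φ.1 y * this

/-- The product of the cutoff function and the resolvent of a test function. -/
def cutoffResolvent (k R : ℝ) : testSpace →ₗ[ℂ] 𝓢(R3, ℂ) where
  toFun φ := cutoffMul R (resolvent k φ.1) (contDiff_resolvent k φ.2 (φ.1.smooth ⊤))
  map_add' φ ψ := by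
    ext x
    have h1 : (φ + ψ).1 = φ.1 + ψ.1 := rfl
    have h2 : resolvent k (φ + ψ).1 x = resolvent k φ.1 x + resolvent k ψ.1 x := by
      rw [resolvent, resolvent, resolvent, ← integral_add (integrable_fundSol_mul k x φ)
        (integrable_fundSol_mul k x ψ)]
      refine integral_congr_ae (Eventually.of_forall fun y => ?_)
      have : (φ + ψ).1 y = φ.1 y + ψ.1 y := rfl
      simp only [this]
      ring
    rw [add_apply, cutoffMul_apply, cutoffMul_apply, cutoffMul_apply, h2, mul_add]
  map_smul' c φ := by
    ext x
    have h2 : resolvent k (c • φ).1 x = c * resolvent k φ.1 x := by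
      rw [resolvent, resolvent, ← integral_const_mul]
      refine integral_congr_ae (Eventually.of_forall fun y => ?_)
      have : (c • φ).1 y = c * φ.1 y := rfl
      simp only [this]
      ring
    rw [RingHom.id_apply, smul_apply, cutoffMul_apply, cutoffMul_apply, h2, smul_eq_mul]
    ring

theorem cutoffResolvent_apply (k R : ℝ) (φ : testSpace) (x : R3) :
    cutoffResolvent k R φ x = cutoff R x * resolvent k φ.1 x := rfl

theorem tsupport_cutoffResolvent (k R : ℝ) (φ : testSpace) :
    tsupport (cutoffResolvent k R φ) ⊆ Metric.closedBall 0 (|R| + 2) :=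
  tsupport_cutoffMul R _ (contDiff_resolvent k φ.2 (φ.1.smooth ⊤))

/-- Bessel's inequality for the fundamental solution. -/
theorem tsum_enorm_resolvent_sq_le {ρ : R3 → ℝ} (hρ : Continuous ρ) (hρ0 : ∀ x, 0 < ρ x) (k : ℝ)
    {ι : Type*} {e : ι → testSpace} (he : Orthonormal ℂ fun i => divWeight hρ hρ0 (e i)) (x : R3) :
    ∑' i, ‖resolvent k (e i).1 x‖ₑ ^ 2 ≤ ∫⁻ y, ‖fundSol k x y * ((ρ y : ℝ) : ℂ)‖ₑ ^ 2 := by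
  by_cases hfin : ∫⁻ y, ‖fundSol k x y * ((ρ y : ℝ) : ℂ)‖ₑ ^ 2 = ⊤
  · rw [hfin]; exact le_top
  have hm : Measurable fun y => fundSol k x y * ((ρ y : ℝ) : ℂ) :=
    ((measurable_fundSol k).comp measurable_prodMk_left).mul
      (Complex.continuous_ofReal.comp hρ).measurable
  have hg : MemLp (fun y => fundSol k x y * ((ρ y : ℝ) : ℂ)) 2 volume :=
    memLp_two_iff_lintegral.2 ⟨hm.aestronglyMeasurable, hfin⟩
  -- The value `R_k e_i (x)` is the inner product of this vector with `e_i / ρ`: the weights cancel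
  -- and the conjugations undo each other.
  set g := hg.star.toLp _ with hgdef
  have hinner : ∀ i, resolvent k (e i).1 x = inner ℂ g (divWeight hρ hρ0 (e i)) := by
    intro i
    rw [L2.inner_def, resolvent]
    refine integral_congr_ae ?_
    filter_upwards [hg.star.coeFn_toLp, coeFn_divWeight hρ hρ0 (e i)] with y h1 h2
    rw [hgdef, h1, h2, RCLike.inner_apply]
    have hne : ((ρ y : ℝ) : ℂ) ≠ 0 := by exact_mod_cast (hρ0 y).ne'
    simp only [Pi.star_apply, RCLike.star_def, Complex.conj_conj]
    push_cast
    field_simp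
  have hnorm : ∀ i, ‖resolvent k (e i).1 x‖ₑ ^ 2
      = ENNReal.ofReal (‖inner ℂ (divWeight hρ hρ0 (e i)) g‖ ^ 2) := by
    intro i
    rw [hinner, norm_inner_symm, ENNReal.ofReal_pow (norm_nonneg _), ofReal_norm]
  simp_rw [hnorm]
  rw [← ENNReal.ofReal_tsum_of_nonneg (fun i => by positivity) (he.inner_products_summable g)]
  refine (ENNReal.ofReal_le_ofReal (he.tsum_inner_products_le g)).trans (le_of_eq ?_)
  rw [ENNReal.ofReal_pow (norm_nonneg _), ofReal_norm, hgdef, enorm_toLp_sq hg.star]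
  refine lintegral_congr fun y => ?_
  rw [Pi.star_apply, ← ofReal_norm, norm_star, ofReal_norm]

variable {Ω : Type*} [MeasurableSpace Ω] {P : Measure Ω} [IsProbabilityMeasure P]
  {f : Ω → 𝓢'(R3, ℂ)} {D : Set R3} {m : ℝ} {μ : R3 → ℝ}

/-- Almost surely, the resolvent of the random distribution has square-summable coefficients. -/
theorem IsMIGR.ae_summable_sq (hf : IsMIGR P f D m μ) (hm : 3 / 2 < m) {ρ : R3 → ℝ}
    (hρ : Continuous ρ) (hρ0 : ∀ x, 0 < ρ x) (hρ2 : MemLp ρ 2 volume) (k R : ℝ) {s : Set ℕ}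
    {e : s → testSpace} (he : Orthonormal ℂ fun i => divWeight hρ hρ0 (e i)) :
    ∀ᵐ ω ∂P, Summable fun i => ‖f ω (cutoffResolvent k R (e i))‖ ^ 2 := by
  obtain ⟨C, hC, hmom⟩ := hf.exists_lintegral_sq_le hm (|R| + 2)
  obtain ⟨C', hC', hsol⟩ := exists_setLIntegral_fundSol_le (|R| + 2)
  set K := Metric.closedBall (0 : R3) (|R| + 2)
  have hρ2' := (memLp_two_iff_lintegral.1 (hρ2.ofReal (K := ℂ))).2
  have hmeas : ∀ i, AEMeasurable (fun ω => ‖f ω (cutoffResolvent k R (e i))‖ₑ ^ 2) P := fun i =>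
    (hf.gaussian _).aemeasurable.enorm.pow_const 2
  have hpt : ∀ x, ∑' i, ‖cutoffResolvent k R (e i) x‖ₑ ^ 2
      ≤ K.indicator (fun x => ∫⁻ y, ‖fundSol k x y * ((ρ y : ℝ) : ℂ)‖ₑ ^ 2) x := by
    intro x
    by_cases hx : x ∈ K
    · rw [Set.indicator_of_mem hx]
      refine le_trans (ENNReal.tsum_le_tsum fun i => ?_) (tsum_enorm_resolvent_sq_le hρ hρ0 k he x)
      rw [cutoffResolvent_apply]
      gcongr
      rw [enorm_mul]
      refine mul_le_of_le_one_left' ?_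
      rw [← ofReal_norm]
      exact ENNReal.ofReal_le_one.2 (norm_cutoff_le R x)
    · have : ∀ i, cutoffResolvent k R (e i) x = 0 := fun i =>
        image_eq_zero_of_notMem_tsupport fun h => hx (tsupport_cutoffResolvent k R (e i) h)
      simp [this]
  have hkernel : Measurable fun p : R3 × R3 => ‖fundSol k p.1 p.2 * ((ρ p.2 : ℝ) : ℂ)‖ₑ ^ 2 :=
    ((measurable_fundSol k).mul
      ((Complex.continuous_ofReal.comp hρ).measurable.comp measurable_snd)).enorm.pow_const 2
  have hHS : ∫⁻ x in K, ∫⁻ y, ‖fundSol k x y * ((ρ y : ℝ) : ℂ)‖ₑ ^ 2 ≠ ⊤ := by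
    rw [lintegral_lintegral_swap hkernel.aemeasurable]
    have h1 : ∀ y, ∫⁻ x in K, ‖fundSol k x y * ((ρ y : ℝ) : ℂ)‖ₑ ^ 2
        ≤ C' * ‖((ρ y : ℝ) : ℂ)‖ₑ ^ 2 := by
      intro y
      simp_rw [enorm_mul, mul_pow]
      rw [lintegral_mul_const' _ _ (by finiteness)]
      gcongr
      exact hsol k y
    refine ne_top_of_le_ne_top ?_ (lintegral_mono h1)
    rw [lintegral_const_mul' _ _ hC']
    exact ENNReal.mul_ne_top hC' hρ2'
  -- The second-moment bound reduces the expected sum to `∑ ‖χ R_k e_i‖²_{L²}`, which Bessel's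
  -- inequality bounds by the squared Hilbert-Schmidt norm of the kernel `Φ_k(x, y) ρ(y)` over the
  -- ball.
  have htot : ∫⁻ ω, ∑' i, ‖f ω (cutoffResolvent k R (e i))‖ₑ ^ 2 ∂P ≠ ⊤ := by
    rw [lintegral_tsum hmeas]
    refine ne_top_of_le_ne_top (ENNReal.mul_ne_top hC hHS) ?_
    calc ∑' i, ∫⁻ ω, ‖f ω (cutoffResolvent k R (e i))‖ₑ ^ 2 ∂P
        ≤ ∑' i, C * ∫⁻ x, ‖cutoffResolvent k R (e i) x‖ₑ ^ 2 :=
          ENNReal.tsum_le_tsum fun i => hmom _ (tsupport_cutoffResolvent k R (e i))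
      _ = C * ∫⁻ x, ∑' i, ‖cutoffResolvent k R (e i) x‖ₑ ^ 2 := by
          rw [ENNReal.tsum_mul_left, lintegral_tsum fun i =>
            ((cutoffResolvent k R (e i)).continuous.enorm.measurable.pow_const 2).aemeasurable]
      _ ≤ C * ∫⁻ x, K.indicator (fun x => ∫⁻ y, ‖fundSol k x y * ((ρ y : ℝ) : ℂ)‖ₑ ^ 2) x := by
          gcongr with x
          exact hpt x
      _ = _ := by rw [lintegral_indicator measurableSet_closedBall]
  filter_upwards [ae_lt_top' (AEMeasurable.tsum hmeas) htot] with ω hω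
  have := ENNReal.summable_toReal hω.ne
  simpa only [ENNReal.toReal_pow, toReal_enorm] using this

/-- Almost surely, the resolvent of the random distribution is a function in a weighted `L²`
space. -/
theorem IsMIGR.ae_exists_isResolventOf (hf : IsMIGR P f D m μ) (hm : 3 / 2 < m) {R : ℝ}
    (hD : D ⊆ Metric.closedBall 0 R) {ρ : R3 → ℝ}
    (hρ : Continuous ρ) (hρ0 : ∀ x, 0 < ρ x) (hρ2 : MemLp ρ 2 volume) (k : ℝ) :
    ∀ᵐ ω ∂P, ∃ w : R3 → ℂ, IsResolventOf k (f ω) w ∧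
      MemLp (fun x => ((ρ x : ℝ) : ℂ) * w x) 2 volume := by
  have : Fact ((2 : ENNReal) ≠ ⊤) := ⟨by norm_num⟩
  -- Fixing a countable family beforehand allows one null set to serve all test functions. Density
  -- in both topologies is needed: `f ω` is continuous for the Schwartz topology, the inner product
  -- for L².
  obtain ⟨u, hu⟩ := exists_seq_dense (isCompact_closedBall (0 : R3) (|R| + 2))
    (cutoffResolvent k R) (tsupport_cutoffResolvent k R) (divWeight hρ hρ0)
  obtain ⟨s, e, he, hspan⟩ := exists_orthonormal_lift (divWeight hρ hρ0)
    (divWeight_injective hρ hρ0) u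
  filter_upwards [hf.supported, hf.ae_summable_sq hm hρ hρ0 hρ2 k R he] with ω hsupp hsum
  obtain ⟨W, hW⟩ := exists_inner_eq_of_summable (divWeight hρ hρ0) he
    ((f ω).toLinearMap ∘ₗ cutoffResolvent k R) hsum
  have hall : ∀ φ : testSpace, inner ℂ W (divWeight hρ hρ0 φ) = f ω (cutoffResolvent k R φ) := by
    intro φ
    obtain ⟨t, ht1, ht2⟩ := hu φ
    have h1 := ((map_continuous (f ω)).tendsto _).comp ht1
    have h2 := (tendsto_const_nhds (x := W)).inner (𝕜 := ℂ) ht2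
    refine tendsto_nhds_unique h2 (h1.congr fun n => ?_)
    exact (hW _ (hspan (t n))).symm
  have hWm := Lp.memLp W
  have hinv := continuous_inv_weight hρ hρ0
  -- The inner product of `W` with `φ / ρ` is `∫ W̄ φ / ρ`, so `W̄ / ρ` represents the resolvent,
  -- and multiplication by `ρ` returns `W̄` in L².
  refine ⟨fun x => (((ρ x)⁻¹ : ℝ) : ℂ) * (starRingEnd ℂ) (W x), ⟨?_, ?_⟩, ?_⟩
  · have h1 : LocallyIntegrable (fun x => (starRingEnd ℂ) (W x)) volume :=
      hWm.star.locallyIntegrable (by norm_num)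
    rw [← locallyIntegrableOn_univ] at h1 ⊢
    exact h1.continuousOn_mul hinv.continuousOn isOpen_univ.isLocallyClosed
  · intro φ hφ
    have h1 := hall ⟨φ, hφ⟩
    rw [pairSmooth_eq (hsupp.trans hD) (contDiff_resolvent k hφ (φ.smooth ⊤))]
    refine Eq.trans ?_ h1
    rw [L2.inner_def]
    refine integral_congr_ae ?_
    filter_upwards [coeFn_divWeight hρ hρ0 ⟨φ, hφ⟩] with x hx
    rw [hx, RCLike.inner_apply]
    ring
  · refine hWm.star.ae_eq (Eventually.of_forall fun x => ?_)
    have hne : ((ρ x : ℝ) : ℂ) ≠ 0 := by exact_mod_cast (hρ0 x).ne'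
    simp only [Pi.star_apply, RCLike.star_def]
    push_cast
    field_simp

end RandomResolvent

/-! ### The weight joining the two halves, and the conclusion. -/

section Main

/-- A positive square-integrable weight that dominates `⟨x⟩^{1/2+ε} |V|` and `⟨x⟩^{-3/2-ε}`. -/
def sourceWeight (V : R3 → ℂ) (ε : ℝ) (x : R3) : ℝ :=
  ‖weightedPotential V ε x‖ + japanese x ^ (-(3 / 2 + ε))

theorem sourceWeight_pos (V : R3 → ℂ) (ε : ℝ) (x : R3) : 0 < sourceWeight V ε x :=
  add_pos_of_nonneg_of_pos (norm_nonneg _) (Real.rpow_pos_of_pos (japanese_pos x) _)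

variable {V : R3 → ℂ} {ε : ℝ}

theorem AdmissiblePotential.continuous_sourceWeight (hV : AdmissiblePotential V ε) :
    Continuous (sourceWeight V ε) :=
  hV.continuous_weightedPotential.norm.add (continuous_japanese_rpow _)

theorem AdmissiblePotential.memLp_sourceWeight (hV : AdmissiblePotential V ε) (hε : 0 < ε) :
    MemLp (sourceWeight V ε) 2 volume :=
  hV.memLp_weightedPotential.norm.add (memLp_japanese_rpow (by linarith))

/-- The conclusions of the theorem for a single compactly supported distribution whose resolvent is
square-integrable with respect to the weight. -/
theorem farField_of_isResolventOf (hV : AdmissiblePotential V ε) (hε : 0 < ε) {k : ℝ}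
    (hk : ‖(hV.isHSKernel hε k).toCLM‖ < 1) {T : 𝓢'(R3, ℂ)} {R : ℝ}
    (hT : Distribution.dsupport T ⊆ Metric.closedBall 0 R) {w : R3 → ℂ} (hw : IsResolventOf k T w)
    (hw2 : MemLp (fun x => ((sourceWeight V ε x : ℝ) : ℂ) * w x) 2 volume) :
    HasInverse V ε k T ∧ Integrable (inverseCorrection V ε k T) volume ∧
      MemLp (farField V ε k T) 2 (volume : Measure R3).toSphere := by
  have hwm := hw.1.aestronglyMeasurable
  have hnorm : ∀ x, ‖((sourceWeight V ε x : ℝ) : ℂ) * w x‖ = sourceWeight V ε x * ‖w x‖ := fun x => by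
    rw [norm_mul, Complex.norm_real, Real.norm_eq_abs, abs_of_pos (sourceWeight_pos V ε x)]
  have hVw : MemLp (fun x => weightedPotential V ε x * w x) 2 volume := by
    refine hw2.mono (hV.continuous_weightedPotential.aestronglyMeasurable.mul hwm)
      (Eventually.of_forall fun x => ?_)
    rw [hnorm, norm_mul]
    gcongr
    exact le_add_of_nonneg_right (Real.rpow_nonneg (japanese_pos x).le _)
  have hw3 : MemWeightedLp (-(3 / 2 + ε)) 2 w := by
    rw [memWeightedLp_iff]
    refine hw2.mono ((continuous_ofReal_japanese_rpow _).aestronglyMeasurable.mul hwm)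
      (Eventually.of_forall fun x => ?_)
    rw [hnorm, norm_mul, norm_ofReal_japanese_rpow]
    gcongr
    exact le_add_of_nonneg_left (norm_nonneg _)
  have hinv := hasInverse_of_norm_lt_one hV hε hk hw hVw
  have hint := (isInverseCorrection_inverseCorrection hinv).integrable hV hε hw hw3
  exact ⟨hinv, hint, (continuous_farField hT hint).memLp_of_hasCompactSupport
    (HasCompactSupport.of_compactSpace _)⟩

end Main

end FarField

end

theorem mainTheorem6 (V : FarField.R3 → ℂ) (ε : ℝ) (hε : 0 < ε)
    (hV : FarField.AdmissiblePotential V ε) :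
    ∃ k₀ : ℝ, 0 < k₀ ∧ ∀ k : ℝ, k₀ < k →
      ∀ (Ω : Type*) [MeasurableSpace Ω] (P : Measure Ω) [IsProbabilityMeasure P]
        (f : Ω → 𝓢'(FarField.R3, ℂ)) (D : Set FarField.R3) (m : ℝ) (μ : FarField.R3 → ℝ),
        IsOpen D → Bornology.IsBounded D → 2 < m → FarField.IsMIGR P f D m μ →
        ∃ Ω₀ : Set Ω, P Ω₀ = 0 ∧ ∀ ω : Ω, ω ∉ Ω₀ →
          FarField.HasInverse V ε k (f ω) ∧
          Integrable (FarField.inverseCorrection V ε k (f ω)) volume ∧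
          MemLp (FarField.farField V ε k (f ω)) 2
            (volume : Measure FarField.R3).toSphere := by
  obtain ⟨k₀, hk₀, hk⟩ := hV.exists_norm_toCLM_lt_one hε
  refine ⟨k₀, hk₀, fun k hkk Ω _ P _ f D m μ _ hD hm hf => ?_⟩
  obtain ⟨R, hR⟩ := hD.subset_closedBall 0
  have hae : ∀ᵐ ω ∂P, FarField.HasInverse V ε k (f ω) ∧
      Integrable (FarField.inverseCorrection V ε k (f ω)) volume ∧
      MemLp (FarField.farField V ε k (f ω)) 2 (volume : Measure FarField.R3).toSphere := by
    filter_upwards [hf.supported, hf.ae_exists_isResolventOf (by linarith) hR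
      hV.continuous_sourceWeight (FarField.sourceWeight_pos V ε) (hV.memLp_sourceWeight hε) k]
      with ω hsupp hω
    obtain ⟨w, hw, hw2⟩ := hω
    exact FarField.farField_of_isResolventOf hV hε (hk k hkk) (hsupp.trans hR) hw hw2
  refine ⟨_, ae_iff.1 hae, fun ω hω => ?_⟩
  simpa using hω
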